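/- **Proposition.** Let $G$ be a group isomorphic to $2^4:S_5$, that is, a semidirect product $N\rtimes S_5$ of an elementary abelian group $N$ of order $2^4$ by the symmetric group $S_5$ (for any action of $S_5$ on $N$). Suppose that $G=\langle a,b,c\rangle$ is a triangle-point group: $a,b,c$ and $ab$ have order $2$, and for all $t,s\in a^G\cup b^G\cup c^G\cup (ab)^G$ the product $ts$ has order at most $6$. Let $T\subseteq G$ with $a,b,c,ab\in T$. Then there is no Majorana representation of the form $(G,T,V)$. Here the notions are as follows. Let $V$ be a real inner product space with a commutative bilinear (not necessarily associative) product $\cdot$ such that, for all $u,v,w\in V$, (M1) $(u,v\cdot w)=(u\cdot v,w)$ and (M2) $(u\cdot u,v\cdot v)\ge (u\cdot v,u\cdot v)$. For $a\in V$ put $V^{(a)}_\mu=\{v\in V: a\cdot v=\mu v\}$. The vector $a$ is a *Majorana axis* if * (M3) $(a,a)=1$ and $a\cdot a=a$; * (M4) $V=V^{(a)}_1\oplus V^{(a)}_0\oplus V^{(a)}_{1/4}\oplus V^{(a)}_{1/32}$; * (M5) $V^{(a)}_1=\mathbb R a$; * (M6) the linear map $\tau(a)$ that is $1$ on $V^{(a)}_1\oplus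 V^{(a)}_0\oplus V^{(a)}_{1/4}$ and $-1$ on $V^{(a)}_{1/32}$ preserves the product; * (M7) the linear map $\sigma(a)$ of $V^{(a)}_+=V^{(a)}_1\oplus V^{(a)}_0\oplus V^{(a)}_{1/4}$ that is $1$ on $V^{(a)}_1\oplus V^{(a)}_0$ and $-1$ on $V^{(a)}_{1/4}$ preserves the restriction of the product to $V^{(a)}_+$. The subalgebra generated by $a_0,a_1$ is *of type $2A$ with third basis vector $a_\rho$* if it has basis $a_0,a_1,a_\rho$, where $a_0,a_1,a_\rho$ are idempotents of length $1$, any two distinct ones among them have inner product $\frac18$, and $x\cdot y=\frac18(x+y-z)$ whenever $\{x,y,z\}=\{a_0,a_1,a_\rho\}$. A *Majorana representation* $(G,T,V)$ of a finite group $G$ consists of a set $T$ of involutions of $G$ that generates $G$ and is closed under conjugation; a real inner product space $V$ with a commutative bilinear product satisfying (M1) and (M2) and generated as an algebra by a set $A$ of Majorana axes; a linear representation $\varphi:G\to GL(V)$ preserving both the product and the inner product; and a bijection $\psi:T\to A$ such that $\psi(t^g)=\psi(t)^{\varphi(g)}$ and $\varphi(t)=\tau(\psi(t))$ for all $t\in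 T$, $g\in G$; subject to * (M8) for $t_0,t_1\in T$, if $\psi(t_0),\psi(t_1)$ generate a subalgebra of type $2A$ with third basis vector $a_\rho$, then $t_0t_1\in T$ and $\psi(t_0t_1)=a_\rho$; and if $t_0,t_1,t_2\in T$ satisfy $t_0t_1t_2=1$, then $\psi(t_0),\psi(t_1)$ generate a subalgebra of type $2A$ with third basis vector $\psi(t_2)$. -/

import Mathlib

open scoped InnerProductSpace

namespace Majorana

section Algebra

variable {V : Type*} [NormedAddCommGroup V] [InnerProductSpace ℝ V]

/-- The smallest subspace of `V` that contains `S` and is closed under the bilinear product `m`. -/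
def generatedSubalgebra (m : V →ₗ[ℝ] V →ₗ[ℝ] V) (S : Set V) : Submodule ℝ V :=
  sInf {U : Submodule ℝ V | S ⊆ U ∧ ∀ u ∈ U, ∀ v ∈ U, m u v ∈ U}

/-- The `μ`-eigenspace `V_μ^{(a)} = {v | a · v = μ v}` of the adjoint action of `a`. -/
def adEigenspace (m : V →ₗ[ℝ] V →ₗ[ℝ] V) (a : V) (μ : ℝ) : Submodule ℝ V :=
  Module.End.eigenspace (m a) μ

/-- The four eigenvalues `1, 0, 1/2^2, 1/2^5`. -/
noncomputable def axisEigenvalue : Fin 4 → ℝ := ![1, 0, 1 / 4, 1 / 32]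

/-- `V_+^{(a)} = V_1^{(a)} + V_0^{(a)} + V_{1/4}^{(a)}`. -/
noncomputable def plusSpace (m : V →ₗ[ℝ] V →ₗ[ℝ] V) (a : V) : Submodule ℝ V :=
  adEigenspace m a 1 ⊔ adEigenspace m a 0 ⊔ adEigenspace m a (1 / 4)

/-- `f` is the linear map `τ(a)`: it multiplies `V_μ^{(a)}` by `(-1)^{32 μ}`, so it is `1` on
`V_1`, `V_0`, `V_{1/4}` and `-1` on `V_{1/32}`. When `V` is the sum of these four eigenspaces
there is exactly one such map. -/
def IsTau (m : V →ₗ[ℝ] V →ₗ[ℝ] V) (a : V) (f : V →ₗ[ℝ] V) : Prop :=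
  (∀ u ∈ adEigenspace m a 1, f u = u) ∧
  (∀ u ∈ adEigenspace m a 0, f u = u) ∧
  (∀ u ∈ adEigenspace m a (1 / 4), f u = u) ∧
  (∀ u ∈ adEigenspace m a (1 / 32), f u = -u)

/-- On `V_+^{(a)}` the linear map `f` is `σ(a)`: it multiplies `V_μ^{(a)}` by `(-1)^{4 μ}`, so it
is `1` on `V_1`, `V_0` and `-1` on `V_{1/4}`. (Only the values of `f` on `V_+^{(a)}` matter, and
there they are determined.) -/
def IsSigma (m : V →ₗ[ℝ] V →ₗ[ℝ] V) (a : V) (f : V →ₗ[ℝ] V) : Prop :=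
  (∀ u ∈ adEigenspace m a 1, f u = u) ∧
  (∀ u ∈ adEigenspace m a 0, f u = u) ∧
  (∀ u ∈ adEigenspace m a (1 / 4), f u = -u)

/-- Axioms (M1) and (M2) for a commutative product `m` on a real inner product space. -/
structure IsMajoranaProduct (m : V →ₗ[ℝ] V →ₗ[ℝ] V) : Prop where
  comm : ∀ u v, m u v = m v u
  M1 : ∀ u v w : V, ⟪u, m v w⟫_ℝ = ⟪m u v, w⟫_ℝ
  M2 : ∀ u v : V, ⟪m u v, m u v⟫_ℝ ≤ ⟪m u u, m v v⟫_ℝ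

/-- `a` is a Majorana axis: axioms (M3) to (M7). -/
structure IsMajoranaAxis (m : V →ₗ[ℝ] V →ₗ[ℝ] V) (a : V) : Prop where
  M3_length : ⟪a, a⟫_ℝ = 1
  M3_idem : m a a = a
  M4 : DirectSum.IsInternal (fun i : Fin 4 => adEigenspace m a (axisEigenvalue i))
  M5 : adEigenspace m a 1 = Submodule.span ℝ {a}
  M6 : ∃ τ : V →ₗ[ℝ] V, IsTau m a τ ∧ ∀ u v, m (τ u) (τ v) = τ (m u v)
  M7 : ∃ σ : V →ₗ[ℝ] V, IsSigma m a σ ∧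
    ∀ u ∈ plusSpace m a, ∀ v ∈ plusSpace m a, m (σ u) (σ v) = σ (m u v)

/-- The subalgebra generated by `a₀` and `a₁` is the dihedral algebra of type `2A`, and `r` is
its third basis vector `a_ρ`. -/
structure IsDihedral2A (m : V →ₗ[ℝ] V →ₗ[ℝ] V) (a₀ a₁ r : V) : Prop where
  linearIndependent : LinearIndependent ℝ ![a₀, a₁, r]
  span_eq : Submodule.span ℝ {a₀, a₁, r} = generatedSubalgebra m {a₀, a₁}
  mul_00 : m a₀ a₀ = a₀
  mul_11 : m a₁ a₁ = a₁
  mul_rr : m r r = r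
  mul_01 : m a₀ a₁ = (1 / 8 : ℝ) • (a₀ + a₁ - r)
  mul_0r : m a₀ r = (1 / 8 : ℝ) • (a₀ + r - a₁)
  mul_1r : m a₁ r = (1 / 8 : ℝ) • (a₁ + r - a₀)
  inner_00 : ⟪a₀, a₀⟫_ℝ = 1
  inner_11 : ⟪a₁, a₁⟫_ℝ = 1
  inner_rr : ⟪r, r⟫_ℝ = 1
  inner_01 : ⟪a₀, a₁⟫_ℝ = 1 / 8
  inner_0r : ⟪a₀, r⟫_ℝ = 1 / 8
  inner_1r : ⟪a₁, r⟫_ℝ = 1 / 8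

end Algebra

/-- A Majorana representation `(G, T, V, ·, (,), φ, ψ)` satisfying (M8), on the real inner
product space `V`. Groups act on the left here: `φ g v` is `v^{φ(g⁻¹)}` for the corresponding
right action, so that `ψ(t^g) = ψ(t)^{φ(g)}` becomes `ψ (g t g⁻¹) = φ g (ψ t)`. Only the values of
`ψ` on `T` matter. -/
structure Representation (G : Type*) [Group G] (T : Set G)
    (V : Type*) [NormedAddCommGroup V] [InnerProductSpace ℝ V] where
  finite : Finite G
  T_order : ∀ t ∈ T, orderOf t = 2
  T_stable : ∀ g : G, ∀ t ∈ T, g * t * g⁻¹ ∈ T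
  T_generates : Subgroup.closure T = ⊤
  /-- the algebra product -/
  mul : V →ₗ[ℝ] V →ₗ[ℝ] V
  isMajoranaProduct : IsMajoranaProduct mul
  /-- the set `A` of Majorana axes -/
  axes : Set V
  isMajoranaAxis : ∀ a ∈ axes, IsMajoranaAxis mul a
  axes_generate : generatedSubalgebra mul axes = ⊤
  φ : G →* (V ≃ₗ[ℝ] V)
  φ_mul : ∀ g u v, φ g (mul u v) = mul (φ g u) (φ g v)
  φ_inner : ∀ g u v, ⟪φ g u, φ g v⟫_ℝ = ⟪u, v⟫_ℝ
  ψ : G → V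
  ψ_bijOn : Set.BijOn ψ T axes
  ψ_equivariant : ∀ g : G, ∀ t ∈ T, ψ (g * t * g⁻¹) = φ g (ψ t)
  /-- `t` acts on `V` as the Majorana involution of the axis `ψ t` -/
  φ_eq_tau : ∀ t ∈ T, IsTau mul (ψ t) (φ t : V →ₗ[ℝ] V)
  M8_of_2A : ∀ t₀ ∈ T, ∀ t₁ ∈ T, ∀ r : V, IsDihedral2A mul (ψ t₀) (ψ t₁) r →
    t₀ * t₁ ∈ T ∧ ψ (t₀ * t₁) = r
  M8_of_mul_eq_one : ∀ t₀ ∈ T, ∀ t₁ ∈ T, ∀ t₂ ∈ T, t₀ * t₁ * t₂ = 1 →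
    IsDihedral2A mul (ψ t₀) (ψ t₁) (ψ t₂)

/-- `G = ⟨a, b, c⟩` is a triangle-point group with respect to the generators `a, b, c`. -/
structure IsTrianglePoint {G : Type*} [Group G] (a b c : G) : Prop where
  generates : Subgroup.closure {a, b, c} = ⊤
  order_a : orderOf a = 2
  order_b : orderOf b = 2
  order_c : orderOf c = 2
  order_ab : orderOf (a * b) = 2
  order_mul_le : ∀ t s : G,
    (IsConj a t ∨ IsConj b t ∨ IsConj c t ∨ IsConj (a * b) t) →
    (IsConj a s ∨ IsConj b s ∨ IsConj c s ∨ IsConj (a * b) s) →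
    0 < orderOf (t * s) ∧ orderOf (t * s) ≤ 6

/-- `G ≅ 2^4 : S_5`: `G` is a semidirect product of a normal elementary abelian subgroup of order
`2^4` by the symmetric group `S_5`, for some action of the latter on the former. -/
def IsTwoPowFourSplitS5 (G : Type*) [Group G] : Prop :=
  ∃ θ : Equiv.Perm (Fin 5) →* MulAut (Multiplicative (Fin 4 → ZMod 2)),
    Nonempty (G ≃* (Multiplicative (Fin 4 → ZMod 2) ⋊[θ] Equiv.Perm (Fin 5)))

end Majorana

/-! Let N be the normal subgroup 2^4 and let X be the union of the conjugacy classes of a, b, c and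
ab, so that X lies in T. The proof is a group-theoretic dichotomy followed by a contradiction in the
algebra.

Algebra: suppose T contains every involution of a subgroup D₈ × 2 except possibly wf, where w
generates the derived subgroup of the D₈ = ⟨p, q⟩ and f generates the factor 2. The fusion rules
determine the product ψ(p)·ψ(q) up to a multiple of ψ(p) (`dihedral4B`). Pairing this product with
ψ(f) and with ψ(w), by associativity of the form, gives (ψ(f), ψ(w)) = 1. Both vectors have length
1, hence ψ(f) = ψ(w), against injectivity of ψ (`Representation.false_of_configuration`).

Groups: up to conjugation and renaming within {a, b, ab}, the images of the generators in S₅ form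
one of two triples (`exists_isStandardTriple`). A five-cycle acts nontrivially on N, since otherwise
the generators would not generate; it then has no nonzero fixed vector, and so the fixed vectors of
a double transposition t are exactly the w + tw. If transpositions have this property too, X
contains all involutions over both classes, and D₈ × 2 appears
(`IsTranspositionSet.hasConfiguration`). Otherwise a transposition fixes a hyperplane pointwise and
N is the permutation module of S₅ modulo constants. The bound 6 on orders then restricts the
elements of X over transpositions so strongly that a, b, c lie in a complement of N and cannot
generate G (`IsPermutationSystem.not_isStandardGenerating`). -/

namespace Majorana

/-! ### Eigenvectors and fusion rules of a Majorana axis. -/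

section Fusion

variable {V : Type*} [NormedAddCommGroup V] [InnerProductSpace ℝ V]
  {m : V →ₗ[ℝ] V →ₗ[ℝ] V} {a : V}

theorem mem_adEigenspace {μ : ℝ} {v : V} : v ∈ adEigenspace m a μ ↔ m a v = μ • v :=
  Module.End.mem_eigenspace_iff

theorem IsMajoranaProduct.inner_axis_eq_zero (hm : IsMajoranaProduct m) (ha : m a a = a)
    {μ : ℝ} (hμ : μ ≠ 1) {v : V} (hv : m a v = μ • v) : ⟪a, v⟫_ℝ = 0 := by
  have h := hm.M1 a a v
  rw [ha, hv, real_inner_smul_right] at h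
  have : (μ - 1) * ⟪a, v⟫_ℝ = 0 := by linarith
  exact (mul_eq_zero.mp this).resolve_left (sub_ne_zero.mpr hμ)

/-- The decomposition of a vector along the eigenspaces of an axis. -/
theorem IsMajoranaAxis.exists_decomposition (hm : IsMajoranaProduct m) (h : IsMajoranaAxis m a)
    (x : V) : ∃ y₀ y₁ y₂ : V, m a y₀ = 0 ∧ m a y₁ = (1 / 4 : ℝ) • y₁ ∧
      m a y₂ = (1 / 32 : ℝ) • y₂ ∧ x = ⟪a, x⟫_ℝ • a + y₀ + y₁ + y₂ := by
  have htop := h.M4.submodule_iSup_eq_top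
  have hx : x ∈ ⨆ i : Fin 4, adEigenspace m a (axisEigenvalue i) := htop ▸ Submodule.mem_top
  rw [Submodule.mem_iSup_iff_exists_finsupp] at hx
  obtain ⟨f, hf, hsum⟩ := hx
  rw [Finsupp.sum_fintype _ _ (fun _ => rfl), Fin.sum_univ_four] at hsum
  have h0 := hf 0
  have h1 := hf 1
  have h2 := hf 2
  have h3 := hf 3
  simp only [axisEigenvalue, Matrix.cons_val_zero, Matrix.cons_val_one, Matrix.cons_val] at h0 h1 h2 h3
  rw [h.M5, Submodule.mem_span_singleton] at h0
  obtain ⟨k, hk⟩ := h0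
  rw [mem_adEigenspace] at h1 h2 h3
  have i1 := hm.inner_axis_eq_zero h.M3_idem (by norm_num) h1
  have i2 := hm.inner_axis_eq_zero h.M3_idem (by norm_num) h2
  have i3 := hm.inner_axis_eq_zero h.M3_idem (by norm_num) h3
  refine ⟨f 1, f 2, f 3, by simpa using h1, h2, h3, ?_⟩
  have hkx : ⟪a, x⟫_ℝ = k := by
    rw [← hsum, ← hk]
    simp only [inner_add_right, real_inner_smul_right, i1, i2, i3, h.M3_length]
    ring
  rw [hkx, hk, hsum]

theorem IsTau.sub_eigen (hm : IsMajoranaProduct m) (h : IsMajoranaAxis m a) {τ : V →ₗ[ℝ] V}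
    (hτ : IsTau m a τ) (x : V) : m a (x - τ x) = (1 / 32 : ℝ) • (x - τ x) := by
  obtain ⟨y₀, y₁, y₂, h0, h1, h2, hx⟩ := h.exists_decomposition hm x
  have ta : τ a = a := hτ.1 a (mem_adEigenspace.mpr (by simpa using h.M3_idem))
  have t0 : τ y₀ = y₀ := hτ.2.1 _ (mem_adEigenspace.mpr (by simpa using h0))
  have t1 : τ y₁ = y₁ := hτ.2.2.1 _ (mem_adEigenspace.mpr h1)
  have t2 : τ y₂ = -y₂ := hτ.2.2.2 _ (mem_adEigenspace.mpr h2)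
  have : x - τ x = (2 : ℝ) • y₂ := by
    rw [hx]
    simp only [map_add, map_smul, ta, t0, t1, t2]
    module
  rw [this, map_smul, h2, smul_comm]

theorem IsTau.exists_decomposition (hm : IsMajoranaProduct m) (h : IsMajoranaAxis m a)
    {τ : V →ₗ[ℝ] V} (hτ : IsTau m a τ) {x : V} (hx : τ x = x) :
    ∃ y₀ y₁ : V, m a y₀ = 0 ∧ m a y₁ = (1 / 4 : ℝ) • y₁ ∧ x = ⟪a, x⟫_ℝ • a + y₀ + y₁ := by
  obtain ⟨y₀, y₁, y₂, h0, h1, h2, hd⟩ := h.exists_decomposition hm x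
  refine ⟨y₀, y₁, h0, h1, ?_⟩
  have ta : τ a = a := hτ.1 a (mem_adEigenspace.mpr (by simpa using h.M3_idem))
  have t0 : τ y₀ = y₀ := hτ.2.1 _ (mem_adEigenspace.mpr (by simpa using h0))
  have t1 : τ y₁ = y₁ := hτ.2.2.1 _ (mem_adEigenspace.mpr h1)
  have t2 : τ y₂ = -y₂ := hτ.2.2.2 _ (mem_adEigenspace.mpr h2)
  have hy : y₂ = 0 := by
    have e1 : τ x = ⟪a, x⟫_ℝ • a + y₀ + y₁ - y₂ := by
      conv_lhs => rw [hd]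
      simp only [map_add, map_smul, ta, t0, t1, t2]
      module
    rw [hx] at e1
    have : (2 : ℝ) • y₂ = 0 := by linear_combination (norm := module) e1 - hd
    simpa using this
  rw [hy, add_zero] at hd
  exact hd

/-- The product of two `0`- or two `1/4`-eigenvectors of an axis lies in `V_1 + V_0`. -/
theorem IsMajoranaAxis.mul_mul_of_even (hm : IsMajoranaProduct m) (h : IsMajoranaAxis m a)
    {u v : V} (huv : (m a u = 0 ∧ m a v = 0) ∨
      (m a u = (1 / 4 : ℝ) • u ∧ m a v = (1 / 4 : ℝ) • v)) :
    m a (m u v) = ⟪a, m u v⟫_ℝ • a := by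
  obtain ⟨τ, hτ, hτm⟩ := h.M6
  obtain ⟨σ, hσ, hσm⟩ := h.M7
  -- ε is the common sign of σ(a) on u and v. As ε² = 1, the product is fixed by both τ(a) and σ(a),
  -- which leaves only its components in V_1 and V_0.
  have key : ∃ ε : ℝ, ε * ε = 1 ∧ τ u = u ∧ τ v = v ∧ u ∈ plusSpace m a ∧ v ∈ plusSpace m a ∧
      σ u = ε • u ∧ σ v = ε • v := by
    rcases huv with ⟨hu, hv⟩ | ⟨hu, hv⟩
    · have hu' : u ∈ adEigenspace m a 0 := mem_adEigenspace.mpr (by simpa using hu)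
      have hv' : v ∈ adEigenspace m a 0 := mem_adEigenspace.mpr (by simpa using hv)
      exact ⟨1, by norm_num, hτ.2.1 _ hu', hτ.2.1 _ hv',
        Submodule.mem_sup_left (Submodule.mem_sup_right hu'),
        Submodule.mem_sup_left (Submodule.mem_sup_right hv'),
        by rw [hσ.2.1 _ hu', one_smul], by rw [hσ.2.1 _ hv', one_smul]⟩
    · have hu' := mem_adEigenspace.mpr hu
      have hv' := mem_adEigenspace.mpr hv
      exact ⟨-1, by norm_num, hτ.2.2.1 _ hu', hτ.2.2.1 _ hv',
        Submodule.mem_sup_right hu', Submodule.mem_sup_right hv',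
        by rw [hσ.2.2 _ hu', neg_one_smul], by rw [hσ.2.2 _ hv', neg_one_smul]⟩
  obtain ⟨ε, hε, tu, tv, pu, pv, su, sv⟩ := key
  have ht : τ (m u v) = m u v := by rw [← hτm, tu, tv]
  have hs : σ (m u v) = m u v := by
    rw [← hσm u pu v pv, su, sv, map_smul, map_smul, LinearMap.smul_apply, smul_smul, hε, one_smul]
  obtain ⟨y₀, y₁, h0, h1, hd⟩ := hτ.exists_decomposition hm h ht
  have sa : σ a = a := hσ.1 a (mem_adEigenspace.mpr (by simpa using h.M3_idem))
  have s0 : σ y₀ = y₀ := hσ.2.1 _ (mem_adEigenspace.mpr (by simpa using h0))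
  have s1 : σ y₁ = -y₁ := hσ.2.2 _ (mem_adEigenspace.mpr h1)
  set p := m u v
  have hy : y₁ = 0 := by
    have e1 : σ p = ⟪a, p⟫_ℝ • a + y₀ - y₁ := by
      conv_lhs => rw [hd]
      simp only [map_add, map_smul, sa, s0, s1]
      module
    rw [hs] at e1
    have : (2 : ℝ) • y₁ = 0 := by linear_combination (norm := module) e1 - hd
    simpa using this
  rw [hy, add_zero] at hd
  conv_lhs => rw [hd]
  rw [map_add, map_smul, h0, h.M3_idem, add_zero]

theorem IsMajoranaAxis.mul_mul_zero (hm : IsMajoranaProduct m) (h : IsMajoranaAxis m a)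
    {u v : V} (hu : m a u = 0) (hv : m a v = 0) : m a (m u v) = 0 := by
  have e := h.mul_mul_of_even hm (Or.inl ⟨hu, hv⟩)
  have : ⟪a, m u v⟫_ℝ = 0 := by rw [hm.M1, hu, inner_zero_left]
  rw [e, this, zero_smul]

/-- `τ(a)` exchanges `s` and `r`, in terms of eigenvectors. -/
theorem IsTau.of_swap (hm : IsMajoranaProduct m) (h : IsMajoranaAxis m a)
    {τ : V →ₗ[ℝ] V} (hτ : IsTau m a τ) {s r : V} (hs : τ s = r) (hr : τ r = s) :
    m a (s - r) = (1 / 32 : ℝ) • (s - r) ∧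
    ∃ y₀ y₁ : V, m a y₀ = 0 ∧ m a y₁ = (1 / 4 : ℝ) • y₁ ∧
      s + r = ⟪a, s + r⟫_ℝ • a + y₀ + y₁ := by
  refine ⟨by simpa [hs] using hτ.sub_eigen hm h s, hτ.exists_decomposition hm h ?_⟩
  rw [map_add, hs, hr, add_comm]

end Fusion

/-! ### The product of two axes of type 4B. -/

section Dihedral

variable {V : Type*} [NormedAddCommGroup V] [InnerProductSpace ℝ V]
  {m : V →ₗ[ℝ] V →ₗ[ℝ] V}

/-- With `p = a · s - (a + s) / 32`, the product `a · p` when `τ(a)` exchanges `s` and `r`. -/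
theorem IsMajoranaAxis.mul_sigma {a s r p : V} {l : ℝ} (h : IsMajoranaAxis m a)
    (has : m a s = p + (1 / 32 : ℝ) • (a + s)) (har : m a r = p + (1 / 32 : ℝ) • (a + r))
    (hl : ⟪a, s + r⟫_ℝ = 2 * l)
    (hd : ∃ y₀ y₁ : V, m a y₀ = 0 ∧ m a y₁ = (1 / 4 : ℝ) • y₁ ∧
      s + r = ⟪a, s + r⟫_ℝ • a + y₀ + y₁) :
    m a ((4 : ℝ) • p + (1 / 8 - 4 * l) • a + (1 / 16 : ℝ) • (s + r)) =
        (1 / 4 : ℝ) • ((4 : ℝ) • p + (1 / 8 - 4 * l) • a + (1 / 16 : ℝ) • (s + r)) ∧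
      m a ((7 / 16 : ℝ) • (s + r) - (4 : ℝ) • p + (3 * l - 1 / 8) • a) = 0 ∧
      m a p = (7 / 32 : ℝ) • p + (3 / 4 * l - 25 / 1024) • a + (7 / 2048 : ℝ) • (s + r) := by
  obtain ⟨y₀, y₁, h0, h1, hd⟩ := hd
  rw [hl] at hd
  have hx : m a (s + r) = (2 * l) • a + (1 / 4 : ℝ) • y₁ := by
    rw [hd]
    simp only [map_add, map_smul, h0, h1, h.M3_idem, add_zero]
  have hx' : m a (s + r) = (2 : ℝ) • p + (1 / 16 : ℝ) • a + (1 / 32 : ℝ) • (s + r) := by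
    rw [map_add, has, har]; module
  have e1 : y₁ = (2 : ℝ) • ((4 : ℝ) • p + (1 / 8 - 4 * l) • a + (1 / 16 : ℝ) • (s + r)) := by
    linear_combination (norm := module) (-4 : ℝ) • hx + (4 : ℝ) • hx'
  have e0 : y₀ = (2 : ℝ) • ((7 / 16 : ℝ) • (s + r) - (4 : ℝ) • p + (3 * l - 1 / 8) • a) := by
    rw [e1] at hd
    linear_combination (norm := module) -hd
  have e1' : (4 : ℝ) • p + (1 / 8 - 4 * l) • a + (1 / 16 : ℝ) • (s + r) = (1 / 2 : ℝ) • y₁ := by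
    rw [e1]; module
  refine ⟨by rw [e1', map_smul, h1]; module, ?_, ?_⟩
  · have : (7 / 16 : ℝ) • (s + r) - (4 : ℝ) • p + (3 * l - 1 / 8) • a = (1 / 2 : ℝ) • y₀ := by
      rw [e0]; module
    rw [this, map_smul, h0, smul_zero]
  · have e2 : m a ((4 : ℝ) • p + (1 / 8 - 4 * l) • a + (1 / 16 : ℝ) • (s + r)) =
        (1 / 4 : ℝ) • ((4 : ℝ) • p + (1 / 8 - 4 * l) • a + (1 / 16 : ℝ) • (s + r)) := by
      rw [e1', map_smul, h1]; module
    rw [map_add, map_add, map_smul, map_smul, map_smul, h.M3_idem, hx'] at e2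
    linear_combination (norm := module) (1 / 4 : ℝ) • e2

/-- Two axes `a`, `s` whose involutions have a product of order `4`, such that `a, b, e` and
`s, r, e` are bases of algebras of type `2A`, where `b` and `r` are the images of `a` and `s`. -/
theorem dihedral4B (hm : IsMajoranaProduct m) {a b e s r : V}
    (ha : IsMajoranaAxis m a) (hb : IsMajoranaAxis m b) (he : IsMajoranaAxis m e)
    (hab : IsDihedral2A m a b e) (hsr : IsDihedral2A m s r e)
    (ha₁ : m a (s - r) = (1 / 32 : ℝ) • (s - r)) (hb₁ : m b (s - r) = (1 / 32 : ℝ) • (s - r))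
    (hs₁ : m s (a - b) = (1 / 32 : ℝ) • (a - b))
    (ha₂ : ∃ y₀ y₁ : V, m a y₀ = 0 ∧ m a y₁ = (1 / 4 : ℝ) • y₁ ∧
      s + r = ⟪a, s + r⟫_ℝ • a + y₀ + y₁)
    (hb₂ : ∃ y₀ y₁ : V, m b y₀ = 0 ∧ m b y₁ = (1 / 4 : ℝ) • y₁ ∧
      s + r = ⟪b, s + r⟫_ℝ • b + y₀ + y₁)
    (hlr : ⟪a, r⟫_ℝ = ⟪a, s⟫_ℝ) (hls : ⟪b, s⟫_ℝ = ⟪a, s⟫_ℝ) (hlbr : ⟪b, r⟫_ℝ = ⟪a, s⟫_ℝ) :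
    ⟪a, s⟫_ℝ = 1 / 64 ∧ ∃ k : ℝ, m a s =
      (1 / 32 : ℝ) • (a + s) - (1 / 64 : ℝ) • (s + r + b - e) + k • a := by
  set l := ⟪a, s⟫_ℝ with hl
  -- The differences s - r and a - b are 1/32-eigenvectors, so the same p serves for all four
  -- products of a or b with s or r.
  obtain ⟨p, hp⟩ : ∃ p, p = m a s - (1 / 32 : ℝ) • (a + s) := ⟨_, rfl⟩
  have mas : m a s = p + (1 / 32 : ℝ) • (a + s) := by rw [hp]; module
  have mar : m a r = p + (1 / 32 : ℝ) • (a + r) := by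
    rw [map_sub] at ha₁
    linear_combination (norm := module) mas - ha₁
  have mbs : m b s = p + (1 / 32 : ℝ) • (b + s) := by
    rw [map_sub, hm.comm s a, hm.comm s b] at hs₁
    linear_combination (norm := module) mas - hs₁
  have mbr : m b r = p + (1 / 32 : ℝ) • (b + r) := by
    rw [map_sub] at hb₁
    linear_combination (norm := module) mbs - hb₁
  obtain ⟨a1, a0, ap⟩ := ha.mul_sigma mas mar
    (by rw [inner_add_right, hlr, ← hl]; ring) ha₂
  obtain ⟨-, -, bp⟩ := hb.mul_sigma mbs mbr
    (by rw [inner_add_right, hls, hlbr]; ring) hb₂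
  have ab := hab.mul_01
  have ae := hab.mul_0r
  have be := hab.mul_1r
  have se := hsr.mul_0r
  have re := hsr.mul_1r
  have ea : m e a = (1 / 8 : ℝ) • (a + e - b) := by rw [hm.comm, ae]
  have eb : m e b = (1 / 8 : ℝ) • (b + e - a) := by rw [hm.comm, be]
  have es : m e s = (1 / 8 : ℝ) • (s + e - r) := by rw [hm.comm, se]
  have er : m e r = (1 / 8 : ℝ) • (r + e - s) := by rw [hm.comm, re]
  have aa := ha.M3_idem
  have bb := hb.M3_idem
  have ee := he.M3_idem
  -- Both vectors below are 0-eigenvectors of e, hence so is their product; this determines e · p.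
  have ep : m e p = (1 / 128 : ℝ) • e := by
    have h := he.mul_mul_zero hm (u := a + b - (1 / 4 : ℝ) • e) (v := s + r - (1 / 4 : ℝ) • e)
      (by simp only [map_add, map_sub, map_smul, ea, eb, ee]; module)
      (by simp only [map_add, map_sub, map_smul, es, er, ee]; module)
    simp only [map_add, map_sub, map_smul, LinearMap.add_apply, LinearMap.sub_apply,
      LinearMap.smul_apply, mas, mar, mbs, mbr, ae, be, ea, eb, ee, es, er] at h
    linear_combination (norm := module) (1 / 4 : ℝ) • h
  have hea : ⟪e, a⟫_ℝ = 1 / 8 := by rw [real_inner_comm, hab.inner_0r]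
  have heb : ⟪e, b⟫_ℝ = 1 / 8 := by rw [real_inner_comm, hab.inner_1r]
  -- The product of two 0-eigenvectors of a is annihilated by a. This leaves a multiple of a fixed
  -- vector with factor 3/64 - 3l, and that vector is nonzero because its inner product with e is
  -- -1/8.
  have hlv : l = 1 / 64 := by
    have h := ha.mul_mul_zero hm (u := b + e - (1 / 4 : ℝ) • a) (v := _)
      (by simp only [map_add, map_sub, map_smul, ab, ae, aa]; module) a0
    simp only [map_add, map_sub, map_smul, LinearMap.add_apply, LinearMap.sub_apply,
      LinearMap.smul_apply, mas, mar, mbs, mbr, ab, ae, ea, es, er, ap, bp, ep,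
      hm.comm b a, aa] at h
    have h2 : (3 / 64 - 3 * l) • ((1 / 8 : ℝ) • (a + b - e) - (1 / 4 : ℝ) • a) = 0 := by
      linear_combination (norm := module) h
    have h3 := congrArg (fun v => ⟪e, v⟫_ℝ) h2
    simp only [inner_add_right, inner_sub_right, real_inner_smul_right, hea, heb, hab.inner_rr,
      inner_zero_right] at h3
    linarith
  refine ⟨hlv, ?_⟩
  -- The product of the 1/4-eigenvectors b - e and `a1` lies in V_1 + V_0, so a maps it to a
  -- multiple k of a. Solving for p leaves only the coefficient of a undetermined.
  have h := ha.mul_mul_of_even hm (u := b - e) (v := _) (Or.inr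
    ⟨by simp only [map_sub, ab, ae]; module, a1⟩)
  set k := ⟪a, _⟫_ℝ with hk
  clear_value k
  simp only [map_add, map_sub, map_smul, LinearMap.sub_apply, mas, mar, mbs, mbr, ab, ae, ea, es,
    er, ap, bp, ep, hm.comm b a, aa, hlv] at h
  refine ⟨4 * k + 3 / 32, ?_⟩
  rw [mas]
  linear_combination (norm := module) (4 : ℝ) • h

end Dihedral

/-! ### The contradiction from D₈ × 2. -/

section Configuration

variable {G : Type*} [Group G] {T : Set G} {V : Type*} [NormedAddCommGroup V]
  [InnerProductSpace ℝ V]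

theorem Representation.mul_self (R : Representation G T V) {t : G} (ht : t ∈ T) : t * t = 1 := by
  have h := pow_orderOf_eq_one t
  rwa [R.T_order t ht, pow_two] at h

theorem Representation.axis (R : Representation G T V) {t : G} (ht : t ∈ T) :
    IsMajoranaAxis R.mul (R.ψ t) :=
  R.isMajoranaAxis _ (R.ψ_bijOn.mapsTo ht)

/-- Two commuting involutions of `T` with product in `T` give an algebra of type `2A`. -/
theorem Representation.dihedral2A (R : Representation G T V) {x w : G} (hx : x ∈ T) (hw : w ∈ T)
    (hxw : x * w ∈ T) : IsDihedral2A R.mul (R.ψ x) (R.ψ (x * w)) (R.ψ w) :=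
  R.M8_of_mul_eq_one x hx _ hxw w hw (by
    rw [← mul_assoc x x w, R.mul_self hx, one_mul, R.mul_self hw])

/-- The product of two axes in the case `4B`. -/
theorem Representation.dihedral4B (R : Representation G T V) {p q w : G} (hp : p ∈ T)
    (hq : q ∈ T) (hw : w ∈ T) (hpw : p * w ∈ T) (hqw : q * w ∈ T)
    (hcp : p * w = w * p) (hcq : q * w = w * q) (hqp : q * p = p * w * q) :
    ⟪R.ψ p, R.ψ q⟫_ℝ = 1 / 64 ∧ ∃ k : ℝ, R.mul (R.ψ p) (R.ψ q) =
      (1 / 32 : ℝ) • (R.ψ p + R.ψ q) -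
        (1 / 64 : ℝ) • (R.ψ q + R.ψ (q * w) + R.ψ (p * w) - R.ψ w) + k • R.ψ p := by
  have pp := R.mul_self hp
  have qq := R.mul_self hq
  have ww := R.mul_self hw
  have c1 : q * p * q⁻¹ = p * w := by rw [hqp, mul_inv_cancel_right]
  have c2 : q * (p * w) * q⁻¹ = p := by
    rw [← mul_assoc, hqp, mul_assoc (p * w) q w, hcq, ← mul_assoc (p * w), mul_inv_cancel_right,
      mul_assoc, ww, mul_one]
  have hpq : p * q = q * w * p := by
    have := hqp
    rw [hcp, mul_assoc] at this
    rw [hcq, mul_assoc, this, ← mul_assoc, ww, one_mul]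
  have c3 : p * q * p⁻¹ = q * w := by rw [hpq, mul_inv_cancel_right]
  have c4 : p * (q * w) * p⁻¹ = q := by
    rw [← mul_assoc, hpq, mul_assoc (q * w) p w, hcp, ← mul_assoc (q * w), mul_inv_cancel_right,
      mul_assoc, ww, mul_one]
  have c5 : p * w * q * (p * w)⁻¹ = q * w := by
    rw [show p * w * q * (p * w)⁻¹ = p * (w * q * w⁻¹) * p⁻¹ by group, ← hcq, mul_inv_cancel_right, c3]
  have c6 : p * w * (q * w) * (p * w)⁻¹ = q := by
    rw [show p * w * (q * w) * (p * w)⁻¹ = p * (w * q) * p⁻¹ by group, ← hcq, c4]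
  have act : ∀ g x y : G, x ∈ T → g * x * g⁻¹ = y → R.φ g (R.ψ x) = R.ψ y := by
    intro g x y hx h
    rw [← h, R.ψ_equivariant g x hx]
  have tau := fun t ht => R.φ_eq_tau t ht
  obtain ⟨a1, a2⟩ := (tau p hp).of_swap R.isMajoranaProduct (R.axis hp) (s := R.ψ q)
    (r := R.ψ (q * w)) (act _ _ _ hq c3) (act _ _ _ hqw c4)
  obtain ⟨b1, b2⟩ := (tau _ hpw).of_swap R.isMajoranaProduct (R.axis hpw) (s := R.ψ q)
    (r := R.ψ (q * w)) (act _ _ _ hq c5) (act _ _ _ hqw c6)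
  obtain ⟨s1, -⟩ := (tau q hq).of_swap R.isMajoranaProduct (R.axis hq) (s := R.ψ p)
    (r := R.ψ (p * w)) (act _ _ _ hp c1) (act _ _ _ hpw c2)
  have i1 := R.φ_inner p (R.ψ p) (R.ψ q)
  rw [act p p p hp (by group), act p q _ hq c3] at i1
  have i2 := R.φ_inner q (R.ψ p) (R.ψ q)
  rw [act q p _ hp c1, act q q q hq (by group)] at i2
  have i3 := R.φ_inner q (R.ψ p) (R.ψ (q * w))
  rw [act q p _ hp c1, act q (q * w) (q * w) hqw
    (by rw [hcq, ← mul_assoc, ← hcq, mul_inv_cancel_right]), i1] at i3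
  exact Majorana.dihedral4B R.isMajoranaProduct (R.axis hp) (R.axis hpw) (R.axis hw)
    (R.dihedral2A hp hw hpw) (R.dihedral2A hq hw hqw) a1 b1 s1 a2 b2 i1 i2 i3

/-- There is no Majorana representation of a group that contains a subgroup `D₈ × 2` with ten of
its eleven involutions in `T`. -/
theorem Representation.false_of_configuration (R : Representation G T V) {p q w f : G}
    (hp : p ∈ T) (hq : q ∈ T) (hw : w ∈ T) (hf : f ∈ T) (hpw : p * w ∈ T) (hqw : q * w ∈ T)
    (hpf : p * f ∈ T) (hqf : q * f ∈ T) (hpwf : p * w * f ∈ T) (hqwf : q * w * f ∈ T)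
    (hcp : p * w = w * p) (hcq : q * w = w * q) (hqp : q * p = p * w * q)
    (hfq : q * f = f * q) (hfw : w * f = f * w) (hne : w ≠ f) : False := by
  have hm := R.isMajoranaProduct
  obtain ⟨l1, k, hk⟩ := R.dihedral4B hp hq hw hpw hqw hcp hcq hqp
  have hpfw : p * f * w = p * w * f := by rw [mul_assoc, ← hfw, mul_assoc]
  have l2 := (R.dihedral4B (p := p * f) hpf hq hw (hpfw ▸ hpwf) hqw
    (by rw [hpfw, hcp, mul_assoc]) hcq
    (by rw [← mul_assoc, hqp, hpfw, mul_assoc _ q f, hfq, ← mul_assoc])).1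
  have l3 : ⟪R.ψ (p * w), R.ψ q⟫_ℝ = 1 / 64 := by
    have h := R.φ_inner q (R.ψ p) (R.ψ q)
    rw [← R.ψ_equivariant q p hp, ← R.ψ_equivariant q q hq, mul_inv_cancel_right, hqp,
      mul_inv_cancel_right, l1] at h
    exact h
  have i1 := (R.dihedral2A hp hf hpf)
  have i2 := (R.dihedral2A hq hf hqf).inner_0r
  have i3 := (R.dihedral2A hpw hf hpwf).inner_0r
  have i4 := (R.dihedral2A hqw hf hqwf).inner_0r
  have j1 := (R.dihedral2A hp hw hpw)
  have j2 := (R.dihedral2A hq hw hqw)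
  have e1 : ⟪R.ψ f, R.mul (R.ψ p) (R.ψ q)⟫_ℝ = 1 / 64 := by
    rw [hm.M1, hm.comm, i1.mul_0r, real_inner_smul_left, inner_sub_left, inner_add_left, l1, l2,
      real_inner_comm, i2]
    norm_num
  have e2 : ⟪R.ψ w, R.mul (R.ψ p) (R.ψ q)⟫_ℝ = 1 / 64 := by
    rw [hm.M1, hm.comm, j1.mul_0r, real_inner_smul_left, inner_sub_left, inner_add_left, l1, l3,
      real_inner_comm, j2.inner_0r]
    norm_num
  rw [hk] at e1 e2
  simp only [inner_add_right, inner_sub_right, real_inner_smul_right] at e1 e2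
  rw [real_inner_comm, i1.inner_0r, real_inner_comm (R.ψ q), i2, real_inner_comm (R.ψ (q * w)), i4,
    real_inner_comm (R.ψ (p * w)), i3] at e1
  rw [real_inner_comm, j1.inner_0r, real_inner_comm (R.ψ q), j2.inner_0r,
    real_inner_comm (R.ψ (q * w)), j2.inner_1r, real_inner_comm (R.ψ (p * w)), j1.inner_1r,
    j1.inner_rr] at e2
  -- The expansions `e1` and `e2` agree except for (ψ(f), ψ(w)) in one and (ψ(w), ψ(w)) = 1 in the
  -- other. The unknown k cancels, since ψ(p) has inner product 1/8 with both ψ(f) and ψ(w).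
  have h1 : ⟪R.ψ f, R.ψ w⟫_ℝ = 1 := by linarith
  have h2 : R.ψ f - R.ψ w = 0 := by
    rw [← inner_self_eq_zero (𝕜 := ℝ), inner_sub_sub_self, real_inner_comm (R.ψ f) (R.ψ w), h1,
      (R.axis hf).M3_length, (R.axis hw).M3_length]
    norm_num
  exact hne (R.ψ_bijOn.injOn hw hf (sub_eq_zero.mp h2).symm)

end Configuration

/-! ### Generating triples of involutions in S₅. -/

section SymmetricGroup

open Equiv

/-- The elements of `S₅` with square `1`. -/
def involutions : List (Perm (Fin 5)) :=
  1 :: [(0, 1), (0, 2), (0, 3), (0, 4), (1, 2), (1, 3), (1, 4), (2, 3), (2, 4), (3, 4)].map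
      (fun x : Fin 5 × Fin 5 => swap x.1 x.2) ++
    [(0, 1, 2, 3), (0, 2, 1, 3), (0, 3, 1, 2), (0, 1, 2, 4), (0, 2, 1, 4), (0, 4, 1, 2),
      (0, 1, 3, 4), (0, 3, 1, 4), (0, 4, 1, 3), (0, 2, 3, 4), (0, 3, 2, 4), (0, 4, 2, 3),
      (1, 2, 3, 4), (1, 3, 2, 4), (1, 4, 2, 3)].map
      (fun x : Fin 5 × Fin 5 × Fin 5 × Fin 5 => swap x.1 x.2.1 * swap x.2.2.1 x.2.2.2)

theorem mem_involutions : ∀ a : Perm (Fin 5), a * a = 1 → a ∈ involutions := by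
  decide +kernel

theorem conj_involution_perm_five : ∀ a ∈ involutions,
    ∃ h : Perm (Fin 5), h * a * h⁻¹ = 1 ∨ h * a * h⁻¹ = swap 0 1 ∨
      h * a * h⁻¹ = swap 0 1 * swap 2 3 := by
  decide +kernel

/-- `g` stabilizes the set `{i, j}`. -/
def StabPair (i j : Fin 5) (g : Perm (Fin 5)) : Prop :=
  (g i = i ∧ g j = j) ∨ (g i = j ∧ g j = i)

instance (i j : Fin 5) (g : Perm (Fin 5)) : Decidable (StabPair i j g) :=
  inferInstanceAs (Decidable (_ ∨ _))

/-- Up to conjugation, `(a, b, c)` is one of two triples of involutions that generate `S₅`. -/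
def IsStandardTriple (a b c : Perm (Fin 5)) : Prop :=
  (a = swap 0 1 * swap 2 3 ∧ b = swap 0 2 * swap 1 3 ∧ c = swap 3 4) ∨
    (a = swap 0 1 ∧ b = swap 2 3 ∧ c = swap 0 4 * swap 1 2)

instance (a b c : Perm (Fin 5)) : Decidable (IsStandardTriple a b c) :=
  inferInstanceAs (Decidable (_ ∨ _))

/-- Permutations that suffice to conjugate generating triples to standard ones. -/
def conjugators : List (Perm (Fin 5)) :=
  [1, swap 2 3, swap 2 4, swap 3 4, swap 2 3 * swap 3 4, swap 3 4 * swap 2 3].flatMap fun w =>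
    [w, swap 0 1 * w, swap 0 2 * swap 1 3 * w, swap 0 2 * swap 1 3 * swap 0 1 * w]

/-- The possibilities for three involutions of `S₅`, the first two of which commute. -/
def TripleAlternative (a b c : Perm (Fin 5)) : Prop :=
  (∃ i j, StabPair i j a ∧ StabPair i j b ∧ StabPair i j c) ∨
    (a.sign = 1 ∧ b.sign = 1 ∧ c.sign = 1) ∨
    ∃ h ∈ conjugators, ∃ x ∈ [(a, b), (b, a), (a, a * b), (a * b, a), (b, a * b), (a * b, b)],
      IsStandardTriple (h * x.1 * h⁻¹) (h * x.2 * h⁻¹) (h * c * h⁻¹)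

instance (a b c : Perm (Fin 5)) : Decidable (TripleAlternative a b c) :=
  inferInstanceAs (Decidable (_ ∨ _ ∨ _))

theorem tripleAlternative_one : ∀ b ∈ involutions,
    ∀ c ∈ involutions, TripleAlternative 1 b c := by
  decide +kernel

theorem tripleAlternative_swap : ∀ b ∈ involutions, swap 0 1 * b = b * swap 0 1 →
    ∀ c ∈ involutions, TripleAlternative (swap 0 1) b c := by
  decide +kernel

theorem tripleAlternative_swap_swap : ∀ b ∈ involutions,
    swap 0 1 * swap 2 3 * b = b * (swap 0 1 * swap 2 3) →
    ∀ c ∈ involutions, TripleAlternative (swap 0 1 * swap 2 3) b c := by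
  decide +kernel

/-- The permutations stabilizing {i, j} form a proper subgroup: the transposition of i with a third
point is not among them. The case i = j is allowed and covers a common fixed point. -/
theorem StabPair.closure_ne_top {i j : Fin 5} {S : Set (Perm (Fin 5))}
    (hS : ∀ g ∈ S, StabPair i j g) : Subgroup.closure S ≠ ⊤ := by
  have key : ∀ i j : Fin 5, ∃ k, k ≠ i ∧ k ≠ j := by decide
  intro h
  have hall : ∀ g : Perm (Fin 5), StabPair i j g := by
    intro g
    have hg : g ∈ Subgroup.closure S := h ▸ Subgroup.mem_top g
    induction hg using Subgroup.closure_induction with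
    | mem x hx => exact hS x hx
    | one => exact Or.inl ⟨rfl, rfl⟩
    | mul x y _ _ hx hy =>
      rcases hx with ⟨h1, h2⟩ | ⟨h1, h2⟩ <;> rcases hy with ⟨h3, h4⟩ | ⟨h3, h4⟩ <;>
        simp [StabPair, h1, h2, h3, h4]
    | inv x _ hx =>
      rcases hx with ⟨h1, h2⟩ | ⟨h1, h2⟩
      · exact Or.inl ⟨by rw [Perm.inv_eq_iff_eq, h1], by rw [Perm.inv_eq_iff_eq, h2]⟩
      · exact Or.inr ⟨by rw [Perm.inv_eq_iff_eq, h2], by rw [Perm.inv_eq_iff_eq, h1]⟩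
  obtain ⟨k, h1, h2⟩ := key i j
  rcases hall (swap i k) with ⟨h3, -⟩ | ⟨h3, -⟩
  · rw [swap_apply_left] at h3; exact h1 h3
  · rw [swap_apply_left] at h3; exact h2 h3

/-- Conjugating and renaming turns a generating triple of `S₅` into a standard one. -/
theorem exists_isStandardTriple {a b c : Perm (Fin 5)} (ha : a * a = 1) (hb : b * b = 1)
    (hc : c * c = 1) (hab : a * b = b * a) (h : Subgroup.closure {a, b, c} = ⊤) :
    ∃ g : Perm (Fin 5), ∃ x ∈ [(a, b), (b, a), (a, a * b), (a * b, a), (b, a * b), (a * b, b)],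
      IsStandardTriple (g * x.1 * g⁻¹) (g * x.2 * g⁻¹) (g * c * g⁻¹) := by
  obtain ⟨g, hg⟩ := conj_involution_perm_five a (mem_involutions a ha)
  have sq : ∀ x : Perm (Fin 5), x * x = 1 → g * x * g⁻¹ ∈ involutions := fun x hx =>
    mem_involutions _ (by rw [show g * x * g⁻¹ * (g * x * g⁻¹) = g * (x * x) * g⁻¹ by group, hx]; group)
  have hcomm : g * a * g⁻¹ * (g * b * g⁻¹) = g * b * g⁻¹ * (g * a * g⁻¹) := by
    rw [show g * a * g⁻¹ * (g * b * g⁻¹) = g * (a * b) * g⁻¹ by group, hab]; group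
  have alt : TripleAlternative (g * a * g⁻¹) (g * b * g⁻¹) (g * c * g⁻¹) := by
    rcases hg with hg | hg | hg <;> rw [hg] at hcomm ⊢
    · exact tripleAlternative_one _ (sq b hb) _ (sq c hc)
    · exact tripleAlternative_swap _ (sq b hb) hcomm _ (sq c hc)
    · exact tripleAlternative_swap_swap _ (sq b hb) hcomm _ (sq c hc)
  rcases alt with ⟨i, j, h1, h2, h3⟩ | ⟨h1, h2, h3⟩ | ⟨k, -, x, hx, hk⟩
  · exfalso
    have conv : ∀ y : Perm (Fin 5), StabPair i j (g * y * g⁻¹) → StabPair (g⁻¹ i) (g⁻¹ j) y := by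
      intro y hy
      rcases hy with ⟨h4, h5⟩ | ⟨h4, h5⟩
      · exact Or.inl ⟨by rw [Perm.eq_inv_iff_eq]; exact h4, by rw [Perm.eq_inv_iff_eq]; exact h5⟩
      · exact Or.inr ⟨by rw [Perm.eq_inv_iff_eq]; exact h4, by rw [Perm.eq_inv_iff_eq]; exact h5⟩
    refine StabPair.closure_ne_top (i := g⁻¹ i) (j := g⁻¹ j) ?_ h
    rintro y (rfl | rfl | rfl)
    exacts [conv _ h1, conv _ h2, conv _ h3]
  · exfalso
    simp only [Perm.sign_mul, Perm.sign_inv] at h1 h2 h3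
    have hle : Subgroup.closure {a, b, c} ≤ Perm.sign.ker := by
      rw [Subgroup.closure_le]
      have hgg : Perm.sign g * Perm.sign g = 1 := Int.units_mul_self _
      rintro y (rfl | rfl | rfl) <;> rw [SetLike.mem_coe, MonoidHom.mem_ker]
      · rw [← h1, mul_right_comm, hgg, one_mul]
      · rw [← h2, mul_right_comm, hgg, one_mul]
      · rw [← h3, mul_right_comm, hgg, one_mul]
    rw [h] at hle
    have := hle (Subgroup.mem_top (swap 0 1))
    rw [MonoidHom.mem_ker, Perm.sign_swap (by decide)] at this
    exact absurd this (by decide)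
  · refine ⟨k * g, ?_⟩
    have e : ∀ y : Perm (Fin 5), k * g * y * (k * g)⁻¹ = k * (g * y * g⁻¹) * k⁻¹ := by
      intro y; group
    have e2 : g * a * g⁻¹ * (g * b * g⁻¹) = g * (a * b) * g⁻¹ := by group
    simp only [List.mem_cons, List.not_mem_nil, or_false, e2] at hx
    simp only [e]
    rcases hx with rfl | rfl | rfl | rfl | rfl | rfl
    · exact ⟨(a, b), by simp, hk⟩
    · exact ⟨(b, a), by simp, hk⟩
    · exact ⟨(a, a * b), by simp, hk⟩
    · exact ⟨(a * b, a), by simp, hk⟩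
    · exact ⟨(b, a * b), by simp, hk⟩
    · exact ⟨(a * b, b), by simp, hk⟩

end SymmetricGroup

/-! ### Coordinates in 2^4 : S₅ and sets of involutions with small products. -/

section Split

open Equiv

/-- The group `2^4 : S₅` for the action `θ`. -/
abbrev SplitGroup (θ : Perm (Fin 5) →* MulAut (Multiplicative (Fin 4 → ZMod 2))) : Type :=
  Multiplicative (Fin 4 → ZMod 2) ⋊[θ] Perm (Fin 5)

variable {θ : Perm (Fin 5) →* MulAut (Multiplicative (Fin 4 → ZMod 2))}

/-- The action on the normal subgroup, written additively. -/
def linearAction (θ : Perm (Fin 5) →* MulAut (Multiplicative (Fin 4 → ZMod 2))) :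
    Perm (Fin 5) →* Module.End (ZMod 2) (Fin 4 → ZMod 2) where
  toFun g := AddMonoidHom.toZModLinearMap 2
    { toFun := fun v => (θ g (Multiplicative.ofAdd v)).toAdd
      map_zero' := by simp
      map_add' := fun v w => by simp }
  map_one' := by ext1; simp; rfl
  map_mul' g h := by ext1; simp; rfl

local notation "ρ" => linearAction θ

/-- The element of `2^4 : S₅` with components `v` and `g`. -/
def pair (θ : Perm (Fin 5) →* MulAut (Multiplicative (Fin 4 → ZMod 2)))
    (v : Fin 4 → ZMod 2) (g : Perm (Fin 5)) : SplitGroup θ :=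
  ⟨Multiplicative.ofAdd v, g⟩

theorem exists_pair (k : SplitGroup θ) : ∃ v g, k = pair θ v g := ⟨_, _, rfl⟩

theorem pair_mul (v w : Fin 4 → ZMod 2) (g h : Perm (Fin 5)) :
    pair θ v g * pair θ w h = pair θ (v + ρ g w) (g * h) := rfl

theorem one_eq_pair : (1 : SplitGroup θ) = pair θ 0 1 := rfl

theorem pair_inj {v w : Fin 4 → ZMod 2} {g h : Perm (Fin 5)} :
    pair θ v g = pair θ w h ↔ v = w ∧ g = h :=
  ⟨fun e => ⟨congrArg (fun k => k.left.toAdd) e, congrArg (fun k => k.right) e⟩,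
    fun e => by rw [e.1, e.2]⟩

theorem zmod_two_add_self (v : Fin 4 → ZMod 2) : v + v = 0 := by
  funext i; exact CharTwo.add_self_eq_zero (v i)

theorem linearAction_mul_apply (g h : Perm (Fin 5)) (v : Fin 4 → ZMod 2) :
    ρ (g * h) v = ρ g (ρ h v) := by rw [map_mul]; rfl

theorem linearAction_one_apply (v : Fin 4 → ZMod 2) : ρ 1 v = v := by rw [map_one]; rfl

theorem linearAction_inv_apply_self (g : Perm (Fin 5)) (v : Fin 4 → ZMod 2) :
    ρ g⁻¹ (ρ g v) = v := by
  rw [← linearAction_mul_apply, inv_mul_cancel, linearAction_one_apply]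

theorem linearAction_apply_inv_self (g : Perm (Fin 5)) (v : Fin 4 → ZMod 2) :
    ρ g (ρ g⁻¹ v) = v := by
  rw [← linearAction_mul_apply, mul_inv_cancel, linearAction_one_apply]

theorem pair_pow (v : Fin 4 → ZMod 2) (g : Perm (Fin 5)) (n : ℕ) :
    pair θ v g ^ n = pair θ (∑ i ∈ Finset.range n, ρ (g ^ i) v) (g ^ n) := by
  induction n with
  | zero => simp [one_eq_pair]
  | succ n ih => rw [pow_succ, ih, pair_mul, Finset.sum_range_succ, ← pow_succ]

/-- A set of involutions closed under conjugation such that products of two of its elements have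
order at most `6`. -/
structure IsTranspositionSet (X : Set (SplitGroup θ)) : Prop where
  conj : ∀ k, ∀ x ∈ X, k * x * k⁻¹ ∈ X
  sq : ∀ x ∈ X, x * x = 1
  order : ∀ x ∈ X, ∀ y ∈ X, 0 < orderOf (x * y) ∧ orderOf (x * y) ≤ 6

namespace IsTranspositionSet

variable {X : Set (SplitGroup θ)} (hX : IsTranspositionSet X)

include hX

theorem fixed {v : Fin 4 → ZMod 2} {g : Perm (Fin 5)} (h : pair θ v g ∈ X) : ρ g v = v := by
  have e := hX.sq _ h
  rw [pair_mul, one_eq_pair, pair_inj] at e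
  have : v + ρ g v = v + v := by rw [e.1, zmod_two_add_self]
  exact add_left_cancel this

theorem translate {v : Fin 4 → ZMod 2} {g : Perm (Fin 5)} (h : pair θ v g ∈ X)
    (w : Fin 4 → ZMod 2) : pair θ (v + (w + ρ g w)) g ∈ X := by
  have e := hX.conj (pair θ w 1) _ h
  have : pair θ w 1 * pair θ v g * (pair θ w 1)⁻¹ = pair θ (v + (w + ρ g w)) g := by
    rw [mul_inv_eq_iff_eq_mul, pair_mul, pair_mul, pair_inj]
    refine ⟨?_, by simp⟩
    rw [linearAction_one_apply, add_assoc, add_assoc, zmod_two_add_self, add_zero, add_comm]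
  rwa [this] at e

theorem conj_perm {v : Fin 4 → ZMod 2} {g : Perm (Fin 5)} (h : pair θ v g ∈ X)
    (k : Perm (Fin 5)) : pair θ (ρ k v) (k * g * k⁻¹) ∈ X := by
  have e := hX.conj (pair θ 0 k) _ h
  have : pair θ 0 k * pair θ v g * (pair θ 0 k)⁻¹ = pair θ (ρ k v) (k * g * k⁻¹) := by
    rw [mul_inv_eq_iff_eq_mul, pair_mul, pair_mul, pair_inj]
    refine ⟨by simp, by group⟩
  rwa [this] at e

/-- The order n of gh divides the order of the product upstairs, which is at most 6 < 2n, so the two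
orders agree. The n-th power of the product is therefore trivial, and the sum is its component in N.
-/
theorem sum_eq_zero {v w : Fin 4 → ZMod 2} {g h : Perm (Fin 5)} (hg : pair θ v g ∈ X)
    (hh : pair θ w h ∈ X) {n : ℕ} (hn : orderOf (g * h) = n) (h6 : 6 < 2 * n) :
    ∑ i ∈ Finset.range n, ρ ((g * h) ^ i) (v + ρ g w) = 0 := by
  obtain ⟨h1, h2⟩ := hX.order _ hg _ hh
  rw [pair_mul] at h1 h2
  have hd : n ∣ orderOf (pair θ (v + ρ g w) (g * h)) := by
    have := orderOf_map_dvd (SemidirectProduct.rightHom (φ := θ)) (pair θ (v + ρ g w) (g * h))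
    rw [← hn]
    exact this
  obtain ⟨k, hk⟩ := hd
  have hk1 : k = 1 := by
    rcases k with _ | _ | k
    · omega
    · rfl
    · rw [hk] at h2
      nlinarith
  rw [hk1, mul_one] at hk
  have e := pow_orderOf_eq_one (pair θ (v + ρ g w) (g * h))
  rw [hk, pair_pow, one_eq_pair, pair_inj] at e
  exact e.1

end IsTranspositionSet

/-- The fixed vectors of `g` are the vectors `w + g w`. -/
def FixedEqRange (θ : Perm (Fin 5) →* MulAut (Multiplicative (Fin 4 → ZMod 2)))
    (g : Perm (Fin 5)) : Prop :=
  ∀ v, linearAction θ g v = v → ∃ w, v = w + linearAction θ g w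

theorem FixedEqRange.conj {g : Perm (Fin 5)} (h : FixedEqRange θ g) (k : Perm (Fin 5)) :
    FixedEqRange θ (k * g * k⁻¹) := by
  intro v hv
  rw [linearAction_mul_apply, linearAction_mul_apply] at hv
  obtain ⟨w, hw⟩ := h (ρ k⁻¹ v) (by
    conv_rhs => rw [← hv]
    rw [linearAction_inv_apply_self])
  refine ⟨ρ k w, ?_⟩
  rw [linearAction_mul_apply, linearAction_mul_apply, linearAction_inv_apply_self, ← map_add, ← hw,
    linearAction_apply_inv_self]

/-- Conjugation by N translates the first component by all vectors w + gw. When these exhaust the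
fixed vectors, one element of X over g brings in every involution over the whole class of g. -/
theorem IsTranspositionSet.mem_of_fixed {X : Set (SplitGroup θ)} (hX : IsTranspositionSet X)
    {u v : Fin 4 → ZMod 2} {g : Perm (Fin 5)} (hP : FixedEqRange θ g) (hu : pair θ u g ∈ X)
    (k : Perm (Fin 5)) (hv : ρ (k * g * k⁻¹) v = v) : pair θ v (k * g * k⁻¹) ∈ X := by
  obtain ⟨w, hw⟩ := hP u (hX.fixed hu)
  have h0 : pair θ 0 g ∈ X := by
    have := hX.translate hu w
    rwa [← hw, zmod_two_add_self] at this
  have h1 := hX.conj_perm h0 k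
  obtain ⟨w', hw'⟩ := hP.conj k v hv
  have h2 := hX.translate h1 w'
  rwa [map_zero, zero_add, ← hw'] at h2

end Split

/-! ### Five-cycles act without nonzero fixed vectors. -/

section Trace

open Equiv

variable {θ : Perm (Fin 5) →* MulAut (Multiplicative (Fin 4 → ZMod 2))}

local notation "ρ" => linearAction θ

/-- A cycle of length five, inverted by `(0 1)(2 3)`. -/
def fiveCycle : Perm (Fin 5) := swap 0 1 * swap 2 3 * (swap 1 2 * swap 3 4)

theorem fiveCycle_pow : fiveCycle ^ 5 = 1 := by decide +kernel

/-- Three involutions of a transposition set that generate `2^4 : S₅` and have standard images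
in `S₅`. -/
structure IsStandardGenerating (X : Set (SplitGroup θ)) (a b c : SplitGroup θ) : Prop where
  a_mem : a ∈ X
  b_mem : b ∈ X
  c_mem : c ∈ X
  comm : a * b = b * a
  closure_eq : Subgroup.closure {a, b, c} = ⊤
  standard : IsStandardTriple a.right b.right c.right

/-- The kernel of the action meets the simple group A₅ in a nontrivial normal subgroup, so it
contains A₅. -/
theorem linearAction_eq_one_of_sign (h : ρ fiveCycle = 1) {g : Perm (Fin 5)} (hg : g.sign = 1) :
    ρ g = 1 := by
  have hs : IsSimpleGroup (alternatingGroup (Fin 5)) := alternatingGroup.isSimpleGroup (by simp)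
  have hN : ((ρ).ker.subgroupOf (alternatingGroup (Fin 5))).Normal := inferInstance
  have hω : fiveCycle ∈ alternatingGroup (Fin 5) := by
    rw [Perm.mem_alternatingGroup]; decide +kernel
  rcases IsSimpleGroup.eq_bot_or_eq_top_of_normal _ hN with hb | ht
  · exfalso
    have h1 : (⟨fiveCycle, hω⟩ : alternatingGroup (Fin 5)) ∈
        (ρ).ker.subgroupOf (alternatingGroup (Fin 5)) := h
    rw [hb, Subgroup.mem_bot, Subtype.ext_iff] at h1
    exact (by decide +kernel : fiveCycle ≠ 1) h1
  · have : (⟨g, Perm.mem_alternatingGroup.mpr hg⟩ : alternatingGroup (Fin 5)) ∈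
        (ρ).ker.subgroupOf (alternatingGroup (Fin 5)) := ht ▸ Subgroup.mem_top _
    exact this

theorem span_three_ne_top (u v w : Fin 4 → ZMod 2) :
    Submodule.span (ZMod 2) {u, v, w} ≠ ⊤ := by
  intro h
  have h1 := finrank_span_finset_le_card (R := ZMod 2) ({u, v, w} : Finset (Fin 4 → ZMod 2))
  have h2 : Finset.card ({u, v, w} : Finset (Fin 4 → ZMod 2)) ≤ 3 := Finset.card_le_three
  rw [Finset.coe_insert, Finset.coe_insert, Finset.coe_singleton, Set.finrank, h, finrank_top,
    Module.finrank_fin_fun] at h1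
  omega

/-- A group generated by three elements whose first components are fixed is too small. -/
theorem closure_ne_top_of_fixed {a b c : SplitGroup θ}
    (ha : ∀ g, ρ g a.left.toAdd = a.left.toAdd) (hb : ∀ g, ρ g b.left.toAdd = b.left.toAdd)
    (hc : ∀ g, ρ g c.left.toAdd = c.left.toAdd) : Subgroup.closure {a, b, c} ≠ ⊤ := by
  intro h
  set M := Submodule.span (ZMod 2) {a.left.toAdd, b.left.toAdd, c.left.toAdd}
  have hM : ∀ g, ∀ v ∈ M, ρ g v = v := by
    intro g v hv
    induction hv using Submodule.span_induction with
    | mem x hx =>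
      rcases hx with rfl | rfl | rfl
      exacts [ha g, hb g, hc g]
    | zero => exact map_zero _
    | add x y _ _ hx hy => rw [map_add, hx, hy]
    | smul r x _ hx => rw [map_smul, hx]
  have hall : ∀ k : SplitGroup θ, k.left.toAdd ∈ M := by
    intro k
    have hk : k ∈ Subgroup.closure {a, b, c} := h ▸ Subgroup.mem_top k
    induction hk using Subgroup.closure_induction with
    | mem x hx => exact Submodule.subset_span (by rcases hx with rfl | rfl | rfl <;> simp)
    | one => exact M.zero_mem
    | mul x y _ _ hx hy =>
      have : (x * y).left.toAdd = x.left.toAdd + ρ x.right y.left.toAdd := rfl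
      rw [this, hM _ _ hy]
      exact M.add_mem hx hy
    | inv x _ hx =>
      have : (x⁻¹).left.toAdd = ρ x.right⁻¹ (-x.left.toAdd) := rfl
      rw [this, hM _ _ (M.neg_mem hx)]
      exact M.neg_mem hx
  refine span_three_ne_top a.left.toAdd b.left.toAdd c.left.toAdd ?_
  rw [eq_top_iff]
  exact fun v _ => hall (pair θ v 1)

/-- If the five-cycle acted trivially, so would A₅, and a vector fixed by one odd permutation would
be fixed by all of S₅. The first components of the three generators turn out to be fixed in this
way, and three vectors cannot span N. -/
theorem IsTranspositionSet.linearAction_fiveCycle_ne_one {X : Set (SplitGroup θ)}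
    (hX : IsTranspositionSet X) {a b c : SplitGroup θ} (h : IsStandardGenerating X a b c) :
    ρ fiveCycle ≠ 1 := by
  intro hω
  have odd : ∀ v g, Perm.sign g ≠ 1 → ρ g v = v → ∀ k, ρ k v = v := by
    intro v g hg hv k
    rcases Int.units_eq_one_or (Perm.sign k) with hk | hk
    · rw [linearAction_eq_one_of_sign hω hk]; rfl
    · have hg' := (Int.units_eq_one_or (Perm.sign g)).resolve_left hg
      have : ρ (k * g⁻¹) = 1 := linearAction_eq_one_of_sign hω (by
        rw [Perm.sign_mul, Perm.sign_inv, hk, hg']; rfl)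
      rw [show k = k * g⁻¹ * g by group, linearAction_mul_apply, hv, this]; rfl
  -- For even g, an odd k is chosen so that g times its conjugate by k has order 5. The vanishing
  -- sum then consists of five copies of v + kv, whence kv = v in characteristic 2.
  have even : ∀ v g, pair θ v g ∈ X → (∃ k : Perm (Fin 5), Perm.sign k ≠ 1 ∧
      (g * (k * g * k⁻¹)) ^ 5 = 1 ∧ g * (k * g * k⁻¹) ≠ 1) → Perm.sign g = 1 →
      ∀ k, ρ k v = v := by
    rintro v g hv ⟨k, hk, h5, h1⟩ hg
    have hord : orderOf (g * (k * g * k⁻¹)) = 5 := 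
      haveI : Fact (Nat.Prime 5) := ⟨by norm_num⟩; orderOf_eq_prime h5 h1
    have e := hX.sum_eq_zero hv (hX.conj_perm hv k) hord (by norm_num)
    have hs : Perm.sign (g * (k * g * k⁻¹)) = 1 := by
      simp [hg]
    simp only [map_pow, linearAction_eq_one_of_sign hω hs, one_pow,
      linearAction_eq_one_of_sign hω hg, Module.End.one_apply, Finset.sum_const,
      Finset.card_range] at e
    have e2 : v + ρ k v = 0 := by
      rw [← e]
      generalize v + ρ k v = u
      rw [show (5 : ℕ) = 2 + 2 + 1 from rfl, add_smul, add_smul, two_smul,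
        zmod_two_add_self, one_smul, zero_add]
    have e3 : ρ k v = v := by
      have : v + ρ k v = v + v := by rw [e2, zmod_two_add_self]
      exact add_left_cancel this
    exact odd v k hk e3
  have key : ∀ x ∈ X, (x.right = swap 0 1 * swap 2 3 ∨ x.right = swap 0 2 * swap 1 3 ∨
      x.right = swap 0 4 * swap 1 2 ∨ x.right = swap 3 4 ∨ x.right = swap 0 1 ∨
      x.right = swap 2 3) → ∀ k, ρ k x.left.toAdd = x.left.toAdd := by
    intro x hx hr
    obtain ⟨v, g, rfl⟩ := exists_pair x
    change g = _ ∨ g = _ ∨ g = _ ∨ g = _ ∨ g = _ ∨ g = _ at hr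
    have hf := hX.fixed hx
    rcases hr with rfl | rfl | rfl | rfl | rfl | rfl
    · exact even _ _ hx ⟨swap 0 1 * swap 1 2 * swap 3 4, by decide +kernel⟩ (by decide +kernel)
    · exact even _ _ hx ⟨swap 0 1 * swap 1 2 * swap 3 4, by decide +kernel⟩ (by decide +kernel)
    · exact even _ _ hx ⟨swap 0 1 * swap 1 2 * swap 3 4, by decide +kernel⟩ (by decide +kernel)
    · exact odd _ _ (by decide +kernel) hf
    · exact odd _ _ (by decide +kernel) hf
    · exact odd _ _ (by decide +kernel) hf
  refine closure_ne_top_of_fixed (key a h.a_mem ?_) (key b h.b_mem ?_) (key c h.c_mem ?_)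
    h.closure_eq <;> rcases h.standard with ⟨h1, h2, h3⟩ | ⟨h1, h2, h3⟩ <;> simp [h1, h2, h3]

/-- A nontrivial element of order five has no nonzero fixed vectors. -/
theorem fiveCycle_fixed (h : ρ fiveCycle ≠ 1) {v : Fin 4 → ZMod 2} (hv : ρ fiveCycle v = v) :
    v = 0 := by
  classical
  have : Fact (Nat.Prime 5) := ⟨by norm_num⟩
  set W : AddSubgroup (Fin 4 → ZMod 2) :=
    (LinearMap.eqLocus (ρ fiveCycle) LinearMap.id).toAddSubgroup with hW
  have h1 := Perm.card_fixedPoints_modEq (α := Fin 4 → ZMod 2) (f := ⇑(ρ fiveCycle))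
    (p := 5) (n := 1) (by
      have : ∀ n : ℕ, (show Function.End (Fin 4 → ZMod 2) from ⇑(ρ fiveCycle)) ^ n =
          (show Function.End (Fin 4 → ZMod 2) from ⇑(ρ (fiveCycle ^ n))) := by
        intro n
        induction n with
        | zero => rw [pow_zero, pow_zero, map_one]; rfl
        | succ n ih => rw [pow_succ, ih, pow_succ, map_mul]; rfl
      refine (this _).trans ?_
      rw [pow_one, fiveCycle_pow, map_one]; rfl)
  have h2 : Fintype.card (Function.fixedPoints ⇑(ρ fiveCycle)) = Nat.card W := by
    rw [← Nat.card_eq_fintype_card]; rfl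
  have h3 : Fintype.card (Fin 4 → ZMod 2) = 16 := by simp [ZMod.card]
  have h4 : Nat.card W ∣ 16 := by
    have := AddSubgroup.card_addSubgroup_dvd_card W
    rwa [Nat.card_eq_fintype_card (α := Fin 4 → ZMod 2), h3] at this
  rw [h2, h3] at h1
  have h5 : Nat.card W ≤ 16 := Nat.le_of_dvd (by norm_num) h4
  -- The number of fixed vectors divides 16 and is congruent to 16 modulo 5, which excludes 2, 4 and
  -- 8.
  have h6 : Nat.card W = 1 ∨ Nat.card W = 16 := by
    generalize Nat.card W = c at h1 h4 h5
    interval_cases c <;> simp_all [Nat.ModEq]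
  rcases h6 with h6 | h6
  · have hb := AddSubgroup.eq_bot_of_card_eq W h6
    have : v ∈ W := hv
    rw [hb] at this
    exact this
  · exfalso
    have ht := AddSubgroup.eq_top_of_card_eq W (by rw [h6, Nat.card_eq_fintype_card, h3])
    refine h (LinearMap.ext fun u => ?_)
    have : u ∈ W := ht ▸ AddSubgroup.mem_top u
    exact this

/-- The trace of a five-cycle vanishes. -/
theorem fiveCycle_trace (h : ρ fiveCycle ≠ 1) (v : Fin 4 → ZMod 2) :
    ∑ i ∈ Finset.range 5, ρ (fiveCycle ^ i) v = 0 := by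
  apply fiveCycle_fixed h
  rw [map_sum]
  simp only [← linearAction_mul_apply, ← pow_succ']
  have e := Finset.sum_range_succ (fun i => ρ (fiveCycle ^ i) v) 5
  rw [Finset.sum_range_succ', fiveCycle_pow, pow_zero] at e
  exact add_right_cancel e

/-- Let t be the double transposition and ω the five-cycle that it inverts. If tv = v, then t maps
ωv to ω⁴v and ω²v to ω³v, and the trace relation v = ωv + ω²v + ω³v + ω⁴v reads v = w + tw with w =
ωv + ω²v. -/
theorem fixedEqRange_swap_mul_swap (h : ρ fiveCycle ≠ 1) :
    FixedEqRange θ (swap 0 1 * swap 2 3) := by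
  intro v hv
  have e := fiveCycle_trace h v
  simp only [Finset.sum_range_succ, Finset.sum_range_zero, pow_zero, zero_add,
    linearAction_one_apply, pow_one] at e
  refine ⟨ρ fiveCycle v + ρ (fiveCycle ^ 2) v, ?_⟩
  have e1 : ρ (swap 0 1 * swap 2 3) (ρ fiveCycle v) = ρ (fiveCycle ^ 4) v := by
    rw [← linearAction_mul_apply, show swap 0 1 * swap 2 3 * fiveCycle =
      fiveCycle ^ 4 * (swap 0 1 * swap 2 3) by decide +kernel, linearAction_mul_apply, hv]
  have e2 : ρ (swap 0 1 * swap 2 3) (ρ (fiveCycle ^ 2) v) = ρ (fiveCycle ^ 3) v := by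
    rw [← linearAction_mul_apply, show swap 0 1 * swap 2 3 * fiveCycle ^ 2 =
      fiveCycle ^ 3 * (swap 0 1 * swap 2 3) by decide +kernel, linearAction_mul_apply, hv]
  rw [map_add, e1, e2]
  refine add_left_cancel (a := v) ?_
  rw [zmod_two_add_self, ← e]
  abel

end Trace

/-! ### The case where the fixed vectors of a transposition g are the w + gw. -/

section FreeAction

open Equiv

variable {θ : Perm (Fin 5) →* MulAut (Multiplicative (Fin 4 → ZMod 2))}

local notation "ρ" => linearAction θ

/-- `X` contains ten of the involutions of a subgroup `D₈ × 2`. -/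
def HasConfiguration {G : Type*} [Group G] (X : Set G) : Prop :=
  ∃ p q w f : G, (p ∈ X ∧ q ∈ X ∧ w ∈ X ∧ f ∈ X) ∧ (p * w ∈ X ∧ q * w ∈ X ∧ p * f ∈ X ∧
    q * f ∈ X ∧ p * w * f ∈ X ∧ q * w * f ∈ X) ∧
    p * w = w * p ∧ q * w = w * q ∧ q * p = p * w * q ∧ q * f = f * q ∧ w * f = f * w ∧ w ≠ f

/-- The last alternative matters for iteration: a vector obtained from z as z or z + gz can keep
invariance under elements that g normalizes. -/
theorem exists_fixed_extend {z : Fin 4 → ZMod 2} (hz : z ≠ 0) {g : Perm (Fin 5)} (hg : g * g = 1) :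
    ∃ y, y ≠ 0 ∧ ρ g y = y ∧ (y = z ∨ y = z + ρ g z) := by
  by_cases h : z + ρ g z = 0
  · refine ⟨z, hz, ?_, Or.inl rfl⟩
    have : z + ρ g z = z + z := by rw [h, zmod_two_add_self]
    exact add_left_cancel this
  · refine ⟨_, h, ?_, Or.inr rfl⟩
    rw [map_add, ← linearAction_mul_apply, hg, linearAction_one_apply, add_comm]

/-- A Sylow `2`-subgroup of `S₅` has a nonzero fixed vector. -/
theorem exists_fixed_sylow : ∃ z : Fin 4 → ZMod 2, z ≠ 0 ∧ ρ (swap 0 1) z = z ∧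
    ρ (swap 2 3) z = z ∧ ρ (swap 0 2 * swap 1 3) z = z := by
  have h0 : (fun _ => 1 : Fin 4 → ZMod 2) ≠ 0 := by decide
  obtain ⟨x, hx0, hx1, -⟩ := exists_fixed_extend (θ := θ) h0
    (g := swap 0 1) (by decide +kernel)
  obtain ⟨y, hy0, hy1, hy2⟩ := exists_fixed_extend (θ := θ) hx0
    (g := swap 2 3) (by decide +kernel)
  have hy3 : ρ (swap 0 1) y = y := by
    rcases hy2 with rfl | rfl
    · exact hx1
    · rw [map_add, ← linearAction_mul_apply,
        show (swap 0 1 * swap 2 3 : Perm (Fin 5)) = swap 2 3 * swap 0 1 by decide +kernel,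
        linearAction_mul_apply, hx1]
  obtain ⟨z, hz0, hz1, hz2⟩ := exists_fixed_extend (θ := θ) hy0
    (g := swap 0 2 * swap 1 3) (by decide +kernel)
  refine ⟨z, hz0, ?_, ?_, hz1⟩
  · rcases hz2 with rfl | rfl
    · exact hy3
    · rw [map_add, hy3, ← linearAction_mul_apply,
        show (swap 0 1 * (swap 0 2 * swap 1 3) : Perm (Fin 5)) =
          swap 0 2 * swap 1 3 * swap 2 3 by decide +kernel,
        linearAction_mul_apply, hy1]
  · rcases hz2 with rfl | rfl
    · exact hy1
    · rw [map_add, hy1, ← linearAction_mul_apply,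
        show (swap 2 3 * (swap 0 2 * swap 1 3) : Perm (Fin 5)) =
          swap 0 2 * swap 1 3 * swap 0 1 by decide +kernel,
        linearAction_mul_apply, hy3]

variable {X : Set (SplitGroup θ)} (hX : IsTranspositionSet X) {a b c : SplitGroup θ}

include hX in
theorem IsTranspositionSet.mem_double (h : IsStandardGenerating X a b c)
    (hP : FixedEqRange θ (swap 0 1 * swap 2 3)) {v : Fin 4 → ZMod 2} {g : Perm (Fin 5)}
    (hg : ∃ k, k * (swap 0 1 * swap 2 3) * k⁻¹ = g) (hv : ρ g v = v) : pair θ v g ∈ X := by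
  obtain ⟨k, rfl⟩ := hg
  rcases h.standard with ⟨h1, -, -⟩ | ⟨-, -, h3⟩
  · exact hX.mem_of_fixed (u := a.left.toAdd) hP (by rw [← h1]; exact h.a_mem) k hv
  · obtain ⟨k', hk'⟩ : ∃ k' : Perm (Fin 5), k' * (swap 0 4 * swap 1 2) * k'⁻¹ = swap 0 1 * swap 2 3 :=
      ⟨swap 3 4 * swap 1 4, by decide +kernel⟩
    have := hX.conj_perm (v := c.left.toAdd) (g := c.right) h.c_mem k'
    rw [h3, hk'] at this
    exact hX.mem_of_fixed hP this k hv

include hX in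
theorem IsTranspositionSet.exists_mem_swap (h : IsStandardGenerating X a b c) :
    ∃ v, pair θ v (swap 0 1) ∈ X := by
  rcases h.standard with ⟨-, -, h3⟩ | ⟨h1, -, -⟩
  · have := hX.conj_perm (v := c.left.toAdd) (g := c.right) h.c_mem
      (swap 0 3 * swap 1 4)
    rw [h3, show swap 0 3 * swap 1 4 * swap 3 4 * (swap 0 3 * swap 1 4)⁻¹ = (swap 0 1 : Perm (Fin 5))
      by decide +kernel] at this
    exact ⟨_, this⟩
  · exact ⟨a.left.toAdd, by rw [← h1]; exact h.a_mem⟩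

include hX in
theorem IsTranspositionSet.hasConfiguration (h : IsStandardGenerating X a b c)
    (hP : FixedEqRange θ (swap 0 1)) : HasConfiguration X := by
  have hD := fixedEqRange_swap_mul_swap (hX.linearAction_fiveCycle_ne_one h)
  obtain ⟨u, hu⟩ := hX.exists_mem_swap h
  obtain ⟨z, hz0, hz1, hz2, hz3⟩ := exists_fixed_sylow (θ := θ)
  have hz4 : ρ (swap 0 1 * swap 2 3) z = z := by rw [linearAction_mul_apply, hz2, hz1]
  have hz5 : ρ (swap 0 3 * swap 1 2) z = z := by
    rw [show (swap 0 3 * swap 1 2 : Perm (Fin 5)) = swap 0 2 * swap 1 3 * (swap 0 1 * swap 2 3)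
      by decide +kernel, linearAction_mul_apply, hz4, hz3]
  have single : ∀ v g, (∃ k, k * swap 0 1 * k⁻¹ = g) → ρ g v = v → pair θ v g ∈ X := by
    rintro v _ ⟨k, rfl⟩ hv
    exact hX.mem_of_fixed hP hu k hv
  have s01 : ∀ v, ρ (swap 0 1) v = v → pair θ v (swap 0 1) ∈ X := fun v hv =>
    single v _ ⟨1, by decide +kernel⟩ hv
  have s23 : ∀ v, ρ (swap 2 3) v = v → pair θ v (swap 2 3) ∈ X := fun v hv =>
    single v _ ⟨swap 0 2 * swap 1 3, by decide +kernel⟩ hv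
  have d1 : ∀ v, ρ (swap 0 1 * swap 2 3) v = v → pair θ v (swap 0 1 * swap 2 3) ∈ X :=
    fun v hv => hX.mem_double h hD ⟨1, by decide +kernel⟩ hv
  have d2 : ∀ v, ρ (swap 0 2 * swap 1 3) v = v → pair θ v (swap 0 2 * swap 1 3) ∈ X :=
    fun v hv => hX.mem_double h hD ⟨swap 1 2, by decide +kernel⟩ hv
  have d3 : ∀ v, ρ (swap 0 3 * swap 1 2) v = v → pair θ v (swap 0 3 * swap 1 2) ∈ X :=
    fun v hv => hX.mem_double h hD ⟨swap 1 3, by decide +kernel⟩ hv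
  have e1 : (swap 0 1 * (swap 0 1 * swap 2 3) : Perm (Fin 5)) = swap 2 3 := by decide +kernel
  have e2 : (swap 0 2 * swap 1 3 * (swap 0 1 * swap 2 3) : Perm (Fin 5)) = swap 0 3 * swap 1 2 := by
    decide +kernel
  have e3 : (swap 2 3 * (swap 0 1 * swap 2 3) : Perm (Fin 5)) = swap 0 1 := by decide +kernel
  have e4 : (swap 0 3 * swap 1 2 * (swap 0 1 * swap 2 3) : Perm (Fin 5)) = swap 0 2 * swap 1 3 := by
    decide +kernel
  -- The D₈ is the Sylow 2-subgroup of the complement S₅, with centre generated by w. The vector z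
  -- is fixed by this Sylow subgroup, and f is w multiplied by z. Thus wf = z lies in N, and its
  -- membership in X is not needed.
  refine ⟨pair θ 0 (swap 0 1), pair θ 0 (swap 0 2 * swap 1 3), pair θ 0 (swap 0 1 * swap 2 3),
    pair θ z (swap 0 1 * swap 2 3), ⟨s01 _ (map_zero _), d2 _ (map_zero _), d1 _ (map_zero _),
      d1 _ hz4⟩, ?_⟩
  simp only [pair_mul, map_zero, add_zero, zero_add, hz1, hz2, hz3, hz5, e1, e2, e3, e4, pair_inj]
  refine ⟨⟨s23 _ (map_zero _), d3 _ (map_zero _), s23 _ hz2, d3 _ hz5, s01 _ hz1, d2 _ hz3⟩,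
    ⟨trivial, ?_⟩, ⟨trivial, ?_⟩, ⟨trivial, ?_⟩, ⟨trivial, ?_⟩, ⟨hz4, trivial⟩,
    fun hne => hz0 (pair_inj.mp hne).1.symm⟩ <;>
  decide +kernel

end FreeAction

/-! ### The other case: N is a quotient of the permutation module. -/

section PermutationModule

open Equiv

variable {θ : Perm (Fin 5) →* MulAut (Multiplicative (Fin 4 → ZMod 2))}

local notation "ρ" => linearAction θ

theorem eq_of_add_eq_zero {v w : Fin 4 → ZMod 2} (h : v + w = 0) : v = w := by
  have : v + w = v + v := by rw [h, zmod_two_add_self]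
  exact (add_left_cancel this).symm

theorem mem_ker_one_add {g : Perm (Fin 5)} {v : Fin 4 → ZMod 2} :
    v ∈ LinearMap.ker (1 + ρ g) ↔ ρ g v = v := by
  rw [LinearMap.mem_ker, LinearMap.add_apply, Module.End.one_apply]
  refine ⟨fun h => (eq_of_add_eq_zero h).symm, fun h => by rw [h, zmod_two_add_self]⟩

/-- Since (1 + g)² = 0, the image of 1 + g lies in its kernel, properly by assumption. The two
dimensions add up to 4, so the kernel has dimension at least 3. -/
theorem three_le_finrank_ker {g : Perm (Fin 5)} (hg : g * g = 1) (hP : ¬ FixedEqRange θ g) :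
    3 ≤ Module.finrank (ZMod 2) (LinearMap.ker (1 + ρ g)) := by
  have hle : LinearMap.range (1 + ρ g) ≤ LinearMap.ker (1 + ρ g) := by
    rintro _ ⟨w, rfl⟩
    rw [mem_ker_one_add, LinearMap.add_apply, Module.End.one_apply, map_add,
      ← linearAction_mul_apply, hg, linearAction_one_apply, add_comm]
  have hlt : LinearMap.range (1 + ρ g) < LinearMap.ker (1 + ρ g) := by
    refine lt_of_le_of_ne hle fun he => hP fun v hv => ?_
    rw [← mem_ker_one_add, ← he] at hv
    obtain ⟨w, hw⟩ := hv
    exact ⟨w, hw.symm⟩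
  have h1 := Submodule.finrank_lt_finrank_of_lt hlt
  have h2 := LinearMap.finrank_range_add_finrank_ker (1 + ρ g)
  rw [Module.finrank_fin_fun] at h2
  omega

/-- Three subspaces of dimension at least 3 in a space of dimension 4 have a nonzero common vector.
Applied to the transpositions (0 3), (1 3), (2 3), this gives a vector fixed by generators of the
stabilizer of 4. -/
theorem exists_fixed_three (hP : ¬ FixedEqRange θ (swap 0 1)) :
    ∃ z : Fin 4 → ZMod 2, z ≠ 0 ∧ ∀ i : Fin 5, i ≠ 4 → ρ (swap i 3) z = z := by
  have hr : ∀ k : Perm (Fin 5), 3 ≤ Module.finrank (ZMod 2)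
      (LinearMap.ker (1 + ρ (k * swap 0 1 * k⁻¹))) := by
    intro k
    refine three_le_finrank_ker (mul_eq_one_iff_eq_inv.mpr (by simp [mul_assoc])) fun h => hP ?_
    have := h.conj k⁻¹
    rwa [show k⁻¹ * (k * swap 0 1 * k⁻¹) * k⁻¹⁻¹ = swap 0 1 by group] at this
  have h0 := hr (swap 1 3)
  have h1 := hr (swap 0 3)
  have h2 := hr (swap 0 3 * swap 1 2)
  rw [show swap 1 3 * swap 0 1 * (swap 1 3)⁻¹ = (swap 0 3 : Perm (Fin 5)) by decide +kernel] at h0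
  rw [show swap 0 3 * swap 0 1 * (swap 0 3)⁻¹ = (swap 1 3 : Perm (Fin 5)) by decide +kernel] at h1
  rw [show swap 0 3 * swap 1 2 * swap 0 1 * (swap 0 3 * swap 1 2)⁻¹ = (swap 2 3 : Perm (Fin 5))
    by decide +kernel] at h2
  set A := LinearMap.ker (1 + ρ (swap 0 3))
  set B := LinearMap.ker (1 + ρ (swap 1 3))
  set C := LinearMap.ker (1 + ρ (swap 2 3))
  have hAB := Submodule.finrank_sup_add_finrank_inf_eq A B
  have hABC := Submodule.finrank_sup_add_finrank_inf_eq (A ⊓ B) C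
  have u1 := Submodule.finrank_le (A ⊔ B)
  have u2 := Submodule.finrank_le (A ⊓ B ⊔ C)
  rw [Module.finrank_fin_fun] at u1 u2
  have hpos : A ⊓ B ⊓ C ≠ ⊥ := by
    intro hb
    rw [hb, finrank_bot] at hABC
    omega
  obtain ⟨z, ⟨⟨hz0, hz1⟩, hz2⟩, hz⟩ := Submodule.exists_mem_ne_zero_of_ne_bot hpos
  refine ⟨z, hz, fun i hi => ?_⟩
  fin_cases i
  · exact mem_ker_one_add.mp hz0
  · exact mem_ker_one_add.mp hz1
  · exact mem_ker_one_add.mp hz2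
  · change ρ (swap 3 3) z = z
    rw [swap_self]; exact linearAction_one_apply z
  · exact absurd rfl hi

/-- Five vectors with sum zero that are permuted by `S₅`, as in the quotient of the permutation
module by the constant vectors. -/
structure IsPermutationSystem (θ : Perm (Fin 5) →* MulAut (Multiplicative (Fin 4 → ZMod 2)))
    (e : Fin 5 → Fin 4 → ZMod 2) : Prop where
  ne_zero : e 4 ≠ 0
  smul : ∀ g i, linearAction θ g (e i) = e (g i)
  sum_eq_zero : ∑ i, e i = 0

/-- The orbit of a vector fixed by the stabilizer of 4 is indexed by the five points. -/
theorem exists_isPermutationSystem (hω : ρ fiveCycle ≠ 1) (hP : ¬ FixedEqRange θ (swap 0 1)) :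
    ∃ e, IsPermutationSystem θ e := by
  obtain ⟨z, hz, hfix⟩ := exists_fixed_three hP
  set e : Fin 5 → Fin 4 → ZMod 2 := fun i => ρ (swap i 4) z with he
  have e4 : e 4 = z := by
    change ρ (swap 4 4) z = z
    rw [swap_self]; exact linearAction_one_apply z
  -- The transpositions (k 3) generate S₅, so equivariance need only be checked for them. For k ≠ 4
  -- they fix z; only k = 4 needs separate treatment.
  have star : ∀ k i, ρ (swap k 3) (e i) = e (swap k 3 i) := by
    intro k i
    by_cases hk : k = 4
    · subst hk
      by_cases hi : i = 4
      · subst hi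
        rw [e4, swap_apply_left, he, swap_comm]
      · by_cases hi3 : i = 3
        · subst hi3
          rw [swap_apply_right, e4]
          change ρ (swap 4 3) (ρ (swap 3 4) z) = z
          rw [← linearAction_mul_apply, swap_comm 4 3, swap_mul_self, linearAction_one_apply]
        · rw [swap_apply_of_ne_of_ne hi hi3]
          change ρ (swap 4 3) (ρ (swap i 4) z) = ρ (swap i 4) z
          rw [← linearAction_mul_apply]
          have : ∀ i : Fin 5, i ≠ 4 → i ≠ 3 →
              swap 4 3 * swap i 4 = swap i 4 * swap i 3 := by decide +kernel
          rw [this i hi hi3, linearAction_mul_apply, hfix i hi]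
    · have : ∀ k : Fin 5, k ≠ 4 → ∀ i : Fin 5,
          swap k 3 * swap i 4 = swap (swap k 3 i) 4 * swap k 3 := by decide +kernel
      change ρ (swap k 3) (ρ (swap i 4) z) = ρ (swap (swap k 3 i) 4) z
      rw [← linearAction_mul_apply, this k hk i, linearAction_mul_apply, hfix k hk]
  have hsmul : ∀ g i, ρ g (e i) = e (g i) := by
    intro g
    have hg : g ∈ Subgroup.closure {σ : Perm (Fin 5) | σ.IsSwap} := by
      rw [Perm.closure_isSwap]; exact Subgroup.mem_top g
    induction hg using Subgroup.closure_induction with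
    | mem x hx =>
      obtain ⟨k, l, hkl, rfl⟩ := hx
      have : ∀ k l : Fin 5, k ≠ l → swap k l = swap k 3 * (swap l 3 * swap k 3) ∨
          swap k l = swap l 3 ∨ swap k l = swap k 3 := by decide +kernel
      intro i
      rcases this k l hkl with h | h | h
      · rw [h, linearAction_mul_apply, linearAction_mul_apply, star, star, star]; rfl
      · rw [h, star]
      · rw [h, star]
    | one => intro i; exact linearAction_one_apply _
    | mul x y _ _ hx hy => intro i; rw [linearAction_mul_apply, hy, hx]; rfl
    | inv x _ hx =>
      intro i
      have := hx (x⁻¹ i)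
      rw [show x (x⁻¹ i) = i by simp] at this
      rw [← this, linearAction_inv_apply_self]
  refine ⟨e, e4 ▸ hz, hsmul, ?_⟩
  -- The five-cycle is transitive, so its trace on `e 4` is the sum of all five vectors.
  have ht := fiveCycle_trace hω (e 4)
  simp only [hsmul, Finset.sum_range_succ, Finset.sum_range_zero, zero_add] at ht
  rw [Fin.sum_univ_five, ← ht]
  rw [show (fiveCycle ^ 0) 4 = 4 by decide +kernel, show (fiveCycle ^ 1) 4 = 2 by decide +kernel,
    show (fiveCycle ^ 2) 4 = 0 by decide +kernel, show (fiveCycle ^ 3) 4 = 1 by decide +kernel,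
    show (fiveCycle ^ 4) 4 = 3 by decide +kernel]
  abel

namespace IsPermutationSystem

variable {e : Fin 5 → Fin 4 → ZMod 2} (he : IsPermutationSystem θ e)

include he

/-- By double transitivity, one coincidence makes all five vectors equal, and their sum would be 5 ·
`e 4` = `e 4` ≠ 0. -/
theorem injective : Function.Injective e := by
  intro i j hij
  by_contra hne
  have hall : ∀ k, k ≠ 4 → e k = e 4 := by
    intro k hk
    have : ∀ i j : Fin 5, i ≠ j → ∀ k : Fin 5, k ≠ 4 →
        ∃ g : Perm (Fin 5), g i = k ∧ g j = 4 := by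
      intro i j hij k hk
      exact ⟨swap 4 (swap i k j) * swap i k, by
        rw [Perm.mul_apply, swap_apply_left, swap_apply_of_ne_of_ne hk]
        intro h
        rw [eq_comm, swap_apply_eq_iff, swap_apply_right] at h
        exact hij h.symm, by rw [Perm.mul_apply, swap_apply_right]⟩
    obtain ⟨g, h1, h2⟩ := this i j hne k hk
    rw [← h1, ← h2, ← he.smul, ← he.smul, hij]
  have hs := he.sum_eq_zero
  rw [Fin.sum_univ_five, hall 0 (by decide), hall 1 (by decide), hall 2 (by decide),
    hall 3 (by decide), zmod_two_add_self, zero_add, zmod_two_add_self, zero_add] at hs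
  exact he.ne_zero hs

theorem swap_sum (n : Fin 5 → ZMod 2) {i j : Fin 5} (hij : i ≠ j) :
    ∑ k, n k • e k + ρ (swap i j) (∑ k, n k • e k) = (n i + n j) • (e i + e j) := by
  have h1 : ρ (swap i j) (∑ k, n k • e k) = ∑ k, n (swap i j k) • e k := by
    rw [map_sum, ← Equiv.sum_comp (swap i j)]
    refine Finset.sum_congr rfl fun k _ => ?_
    rw [map_smul, he.smul, swap_apply_self]
  rw [h1, ← Finset.sum_add_distrib, Finset.sum_eq_add i j hij]
  · rw [swap_apply_left, swap_apply_right]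
    module
  · intro k _ hk
    rw [swap_apply_of_ne_of_ne hk.1 hk.2, zmod_two_add_self]
  · intro h; exact absurd (Finset.mem_univ _) h
  · intro h; exact absurd (Finset.mem_univ _) h

theorem coeff_eq_of_fixed (n : Fin 5 → ZMod 2) {i j : Fin 5}
    (hij : i ≠ j) (h : ρ (swap i j) (∑ k, n k • e k) = ∑ k, n k • e k) : n i = n j := by
  have h1 := he.swap_sum n hij
  rw [h, zmod_two_add_self, eq_comm, smul_eq_zero] at h1
  rcases h1 with h1 | h1
  · exact CharTwo.add_eq_zero.mp h1
  · exact absurd (he.injective (eq_of_add_eq_zero h1)) hij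

/-- A relation among the five vectors is fixed by every transposition and so has constant
coefficients. The relations thus have dimension at most 1, and the span has dimension at least 4. -/
theorem exists_coeff (v : Fin 4 → ZMod 2) : ∃ n : Fin 5 → ZMod 2, v = ∑ k, n k • e k := by
  set f : (Fin 5 → ZMod 2) →ₗ[ZMod 2] (Fin 4 → ZMod 2) := Fintype.linearCombination (ZMod 2) e
    with hf
  have hker : LinearMap.ker f ≤ Submodule.span (ZMod 2) {fun _ => 1} := by
    intro n hn
    rw [LinearMap.mem_ker, hf, Fintype.linearCombination_apply] at hn
    rw [Submodule.mem_span_singleton]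
    refine ⟨n 0, funext fun i => ?_⟩
    rw [Pi.smul_apply, smul_eq_mul, mul_one]
    by_cases hi : i = 0
    · rw [hi]
    · exact (he.coeff_eq_of_fixed n hi (by rw [hn, map_zero])).symm
  have h1 := Submodule.finrank_mono hker
  have h2 := finrank_span_singleton (K := ZMod 2) (v := fun _ : Fin 5 => (1 : ZMod 2)) (by
    intro h; exact absurd (congrFun h 0) (by decide))
  have h3 := LinearMap.finrank_range_add_finrank_ker f
  rw [Module.finrank_fin_fun] at h3
  have h4 : LinearMap.range f = ⊤ := by
    apply Submodule.eq_top_of_finrank_eq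
    have := Submodule.finrank_le (LinearMap.range f)
    rw [Module.finrank_fin_fun] at this ⊢
    omega
  obtain ⟨n, hn⟩ : v ∈ LinearMap.range f := h4 ▸ Submodule.mem_top
  exact ⟨n, by rw [← hn, hf, Fintype.linearCombination_apply]⟩

end IsPermutationSystem

end PermutationModule

/-! ### The generators lie in a complement of N. -/

section PermutationModule

open Equiv

variable {θ : Perm (Fin 5) →* MulAut (Multiplicative (Fin 4 → ZMod 2))}

local notation "ρ" => linearAction θ

theorem zmod_two_add_add : ∀ a b : ZMod 2, a + (a + b) = b := by
  decide

/-- If the three elements lie in the complement `{(m + g m, g)}` they do not generate. -/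
theorem closure_ne_top_of_complement {a b c : SplitGroup θ} (m : Fin 4 → ZMod 2)
    (ha : a.left.toAdd = m + ρ a.right m) (hb : b.left.toAdd = m + ρ b.right m)
    (hc : c.left.toAdd = m + ρ c.right m) : Subgroup.closure {a, b, c} ≠ ⊤ := by
  intro h
  have hall : ∀ k : SplitGroup θ, k.left.toAdd = m + ρ k.right m := by
    intro k
    have hk : k ∈ Subgroup.closure {a, b, c} := h ▸ Subgroup.mem_top k
    induction hk using Subgroup.closure_induction with
    | mem x hx => rcases hx with rfl | rfl | rfl <;> assumption
    | one =>
      change (0 : Fin 4 → ZMod 2) = m + ρ 1 m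
      rw [linearAction_one_apply, zmod_two_add_self]
    | mul x y _ _ hx hy =>
      change x.left.toAdd + ρ x.right y.left.toAdd = m + ρ (x.right * y.right) m
      rw [hx, hy, map_add, linearAction_mul_apply, add_assoc, ← add_assoc (ρ x.right m),
        zmod_two_add_self, zero_add]
    | inv x _ hx =>
      change ρ x.right⁻¹ (-x.left.toAdd) = m + ρ x.right⁻¹ m
      rw [hx, map_neg, map_add, linearAction_inv_apply_self]
      funext i
      simp only [Pi.neg_apply, Pi.add_apply, CharTwo.neg_eq]
      exact add_comm _ _
  have h1 := hall (pair θ (fun _ => 1) 1)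
  change (fun _ => 1 : Fin 4 → ZMod 2) = m + ρ 1 m at h1
  rw [linearAction_one_apply, zmod_two_add_self] at h1
  exact absurd (congrFun h1 0) (by decide)

namespace IsPermutationSystem

variable {e : Fin 5 → Fin 4 → ZMod 2} (he : IsPermutationSystem θ e)
  {X : Set (SplitGroup θ)} (hX : IsTranspositionSet X)

include he hX

theorem coeff_eq_of_mem {n : Fin 5 → ZMod 2} {g : Perm (Fin 5)} (hg : pair θ 0 g ∈ X)
    (hn : pair θ (∑ k, n k • e k) (swap 3 4) ∈ X) {i j : Fin 5} (hij : i ≠ j)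
    (h6 : orderOf (swap 3 4 * g) = 6)
    (ht : ∑ t ∈ Finset.range 6, ∑ k, n k • e (((swap 3 4 * g : Perm (Fin 5)) ^ t) k) =
      (n i + n j) • (e i + e j)) : n i = n j := by
  have h := hX.sum_eq_zero hn hg h6 (by norm_num)
  simp only [map_zero, add_zero, map_sum, map_smul, he.smul] at h
  rw [ht, smul_eq_zero] at h
  rcases h with h | h
  · exact CharTwo.add_eq_zero.mp h
  · exact absurd (he.injective (eq_of_add_eq_zero h)) hij

/-- Invariance under (3 4) gives equal coefficients at 3 and 4. Products with suitable double
transpositions have order 6 in S₅, and the order bound then forces equal coefficients at 0, 1, 2.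
Since `e 0` + `e 1` + `e 2` = `e 3` + `e 4`, only a multiple of the latter remains. -/
theorem eq_smul_of_mem_three_four
    (hD : ∀ g : Perm (Fin 5), (∃ k, k * (swap 0 1 * swap 2 3) * k⁻¹ = g) → pair θ 0 g ∈ X)
    {v : Fin 4 → ZMod 2} (hv : pair θ v (swap 3 4) ∈ X) : ∃ r : ZMod 2, v = r • (e 3 + e 4) := by
  obtain ⟨n, rfl⟩ := he.exists_coeff v
  have h34 := he.coeff_eq_of_fixed n (by decide) (hX.fixed hv)
  have h6 : ∀ g : Perm (Fin 5), g ^ 6 = 1 → g ^ 2 ≠ 1 → g ^ 3 ≠ 1 → orderOf g = 6 := by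
    intro g h1 h2 h3
    refine orderOf_eq_of_pow_and_pow_div_prime (by norm_num) h1 fun p hp hd => ?_
    have : p ≤ 6 := Nat.le_of_dvd (by norm_num) hd
    interval_cases p <;> first | exact h2 | exact h3 | (exfalso; revert hp hd; norm_num)
  have h01 : n 0 = n 1 := by
    refine he.coeff_eq_of_mem hX (hD (swap 0 1 * swap 2 4) ⟨swap 3 4, by decide +kernel⟩) hv
      (by decide) (h6 _ (by decide +kernel) (by decide +kernel) (by decide +kernel)) ?_
    -- Row t lists the images of 0, ..., 4 under the t-th power.
    have hp : ∀ (t : Fin 6) k, ((swap 3 4 * (swap 0 1 * swap 2 4) : Perm (Fin 5)) ^ (t : ℕ)) k =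
        (![![0, 1, 2, 3, 4], ![1, 0, 3, 4, 2], ![0, 1, 4, 2, 3], ![1, 0, 2, 3, 4],
          ![0, 1, 3, 4, 2], ![1, 0, 4, 2, 3]] : Fin 6 → Fin 5 → Fin 5) t k := by
      decide +kernel
    rw [Finset.sum_range]
    simp only [hp]
    simp [Fin.sum_univ_six, Fin.sum_univ_five]
    match_scalars <;> grind
  have h12 : n 1 = n 2 := by
    refine he.coeff_eq_of_mem hX (hD (swap 1 2 * swap 0 4) ⟨swap 0 1 * swap 2 1 * swap 4 3,
      by decide +kernel⟩) hv (by decide) (h6 _ (by decide +kernel) (by decide +kernel) (by decide +kernel)) ?_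
    have hp : ∀ (t : Fin 6) k, ((swap 3 4 * (swap 1 2 * swap 0 4) : Perm (Fin 5)) ^ (t : ℕ)) k =
        (![![0, 1, 2, 3, 4], ![3, 2, 1, 4, 0], ![4, 1, 2, 0, 3], ![0, 2, 1, 3, 4],
          ![3, 1, 2, 4, 0], ![4, 2, 1, 0, 3]] : Fin 6 → Fin 5 → Fin 5) t k := by
      decide +kernel
    rw [Finset.sum_range]
    simp only [hp]
    simp [Fin.sum_univ_six, Fin.sum_univ_five]
    match_scalars <;> grind
  refine ⟨n 0 + n 3, ?_⟩
  have hs := he.sum_eq_zero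
  rw [Fin.sum_univ_five] at hs ⊢
  rw [← h12, ← h01, ← h34]
  have h3 : e 0 + e 1 + e 2 = e 3 + e 4 := eq_of_add_eq_zero (by rw [← hs]; abel)
  rw [← smul_add, ← smul_add, h3, add_assoc, ← smul_add, ← add_smul]

theorem eq_smul_of_mem_swap
    (hD : ∀ g : Perm (Fin 5), (∃ k, k * (swap 0 1 * swap 2 3) * k⁻¹ = g) → pair θ 0 g ∈ X)
    {v : Fin 4 → ZMod 2} {i j : Fin 5} (hv : pair θ v (swap i j) ∈ X) (hij : i ≠ j) :
    ∃ r : ZMod 2, v = r • (e i + e j) := by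
  have key : ∀ i j : Fin 5, i ≠ j → ∃ g : Perm (Fin 5), g i = 3 ∧ g j = 4 := by
    intro i j hij
    refine ⟨swap 4 (swap i 3 j) * swap i 3, ?_, ?_⟩
    · rw [Perm.mul_apply, swap_apply_left, swap_apply_of_ne_of_ne (by decide)]
      intro h
      rw [eq_comm, swap_apply_eq_iff, swap_apply_right] at h
      exact hij h.symm
    · rw [Perm.mul_apply, swap_apply_right]
  obtain ⟨g, h1, h2⟩ := key i j hij
  have h := hX.conj_perm hv g
  rw [← swap_apply_apply, h1, h2] at h
  obtain ⟨r, hr⟩ := he.eq_smul_of_mem_three_four hX hD h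
  refine ⟨r, ?_⟩
  rw [← linearAction_inv_apply_self (θ := θ) g v, hr, map_smul, map_add, he.smul, he.smul, ← h1, ← h2]
  simp

omit hX in
theorem add_swap_mul_swap (n : Fin 5 → ZMod 2) {i j k l : Fin 5} (hij : i ≠ j) (hkl : k ≠ l)
    (hik : i ≠ k) (hil : i ≠ l) (hjk : j ≠ k) (hjl : j ≠ l) :
    ∑ t, n t • e t + ρ (swap i j * swap k l) (∑ t, n t • e t) =
      (n i + n j) • (e i + e j) + (n k + n l) • (e k + e l) := by
  have h1 := he.swap_sum n hij
  have h2 := he.swap_sum n hkl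
  have h3 : ρ (swap k l) (∑ t, n t • e t) = ∑ t, n t • e t + (n k + n l) • (e k + e l) := by
    rw [← h2, ← add_assoc, zmod_two_add_self, zero_add]
  rw [linearAction_mul_apply, h3, map_add, ← add_assoc, h1, map_smul, map_add, he.smul, he.smul,
    swap_apply_of_ne_of_ne hik.symm hjk.symm, swap_apply_of_ne_of_ne hil.symm hjl.symm]

omit he hX in
theorem eq_zero_of_comm {r₁ s₁ r₂ s₂ : ZMod 2} {x y z t : Fin 4 → ZMod 2}
    (h : r₁ • (x + y) + s₁ • (z + t) + (r₂ • (y + t) + s₂ • (x + z)) =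
      r₂ • (x + z) + s₂ • (y + t) + (r₁ • (z + t) + s₁ • (x + y))) :
    (r₁ + s₁ + r₂ + s₂) • (x + y + z + t) = 0 := by
  rw [← sub_eq_zero, CharTwo.sub_eq_add] at h
  rw [← h]
  module

/-- In the permutation module no triple generates. -/
theorem not_isStandardGenerating (hω : ρ fiveCycle ≠ 1) {a b c : SplitGroup θ}
    (h : IsStandardGenerating X a b c) : False := by
  have hP := fixedEqRange_swap_mul_swap hω
  have hD : ∀ g : Perm (Fin 5), (∃ k, k * (swap 0 1 * swap 2 3) * k⁻¹ = g) → pair θ 0 g ∈ X :=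
    fun g hg => hX.mem_double h hP hg (map_zero _)
  have double : ∀ v (i j k l : Fin 5), i ≠ j → k ≠ l → i ≠ k → i ≠ l → j ≠ k → j ≠ l →
      (∃ g, g * (swap 0 1 * swap 2 3) * g⁻¹ = swap i j * swap k l) →
      pair θ v (swap i j * swap k l) ∈ X →
      ∃ r s : ZMod 2, v = r • (e i + e j) + s • (e k + e l) := by
    rintro v i j k l h1 h2 h3 h4 h5 h6 ⟨g, hg⟩ hv
    obtain ⟨w, hw⟩ := hg ▸ hP.conj g v (by rw [hg]; exact hX.fixed hv)
    obtain ⟨n, rfl⟩ := he.exists_coeff w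
    rw [he.add_swap_mul_swap n h1 h2 h3 h4 h5 h6] at hw
    exact ⟨_, _, hw⟩
  obtain ⟨u, ga, rfl⟩ := exists_pair a
  obtain ⟨v, gb, rfl⟩ := exists_pair b
  obtain ⟨w, gc, rfl⟩ := exists_pair c
  have ha := h.a_mem
  have hb := h.b_mem
  have hc := h.c_mem
  have hcomm := h.comm
  rw [pair_mul, pair_mul, pair_inj] at hcomm
  have hcomm := hcomm.1
  rcases h.standard with ⟨h1, h2, h3⟩ | ⟨h1, h2, h3⟩
  · change ga = _ at h1
    change gb = _ at h2
    change gc = _ at h3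
    subst h1 h2 h3
    obtain ⟨r₁, s₁, rfl⟩ := double u 0 1 2 3 (by decide) (by decide) (by decide) (by decide)
      (by decide) (by decide) ⟨1, by decide +kernel⟩ ha
    obtain ⟨r₂, s₂, rfl⟩ := double v 0 2 1 3 (by decide) (by decide) (by decide) (by decide)
      (by decide) (by decide) ⟨swap 1 2, by decide +kernel⟩ hb
    obtain ⟨r₃, rfl⟩ := he.eq_smul_of_mem_swap hX hD hc (by decide)
    -- Commutation of a and b gives (r₁ + s₁ + r₂ + s₂)(`e 0` + `e 1` + `e 2` + `e 3`) = 0, and the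
    -- second factor equals `e 4` ≠ 0.
    have hrs : s₁ = r₁ + r₂ + s₂ := by
      change r₁ • (e 0 + e 1) + s₁ • (e 2 + e 3) +
          ρ (swap 0 1 * swap 2 3) (r₂ • (e 0 + e 2) + s₂ • (e 1 + e 3)) =
        r₂ • (e 0 + e 2) + s₂ • (e 1 + e 3) +
          ρ (swap 0 2 * swap 1 3) (r₁ • (e 0 + e 1) + s₁ • (e 2 + e 3)) at hcomm
      rw [map_add, map_add, map_smul, map_smul, map_smul, map_smul, map_add, map_add, map_add,
        map_add] at hcomm
      simp only [he.smul] at hcomm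
      rw [show (swap 0 1 * swap 2 3 : Perm (Fin 5)) 0 = 1 by decide,
        show (swap 0 1 * swap 2 3 : Perm (Fin 5)) 1 = 0 by decide,
        show (swap 0 1 * swap 2 3 : Perm (Fin 5)) 2 = 3 by decide,
        show (swap 0 1 * swap 2 3 : Perm (Fin 5)) 3 = 2 by decide,
        show (swap 0 2 * swap 1 3 : Perm (Fin 5)) 0 = 2 by decide,
        show (swap 0 2 * swap 1 3 : Perm (Fin 5)) 1 = 3 by decide,
        show (swap 0 2 * swap 1 3 : Perm (Fin 5)) 2 = 0 by decide,
        show (swap 0 2 * swap 1 3 : Perm (Fin 5)) 3 = 1 by decide] at hcomm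
      have h0 := eq_zero_of_comm hcomm
      have hs := he.sum_eq_zero
      rw [Fin.sum_univ_five] at hs
      rw [eq_of_add_eq_zero hs, smul_eq_zero] at h0
      exact (by decide : ∀ r₁ s₁ r₂ s₂ : ZMod 2, r₁ + s₁ + r₂ + s₂ = 0 → s₁ = r₁ + r₂ + s₂)
        _ _ _ _ (h0.resolve_right he.ne_zero)
    -- The coefficients of m must have prescribed sums along the edges 01, 23, 02, 13, 34. Starting
    -- from 0 at the point 0, they are read off along the edges; `hrs` is the consistency condition
    -- on the 4-cycle 0, 1, 3, 2.
    refine closure_ne_top_of_complement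
      (∑ t, (![0, r₁, r₂, r₁ + s₂, r₁ + s₂ + r₃] : Fin 5 → ZMod 2) t • e t) ?_ ?_ ?_ h.closure_eq
    · change _ = _ + ρ (swap 0 1 * swap 2 3) _
      rw [he.add_swap_mul_swap _ (by decide) (by decide) (by decide) (by decide) (by decide)
        (by decide)]
      change _ = (0 + r₁) • (e 0 + e 1) + (r₂ + (r₁ + s₂)) • (e 2 + e 3)
      rw [hrs, zero_add, add_left_comm r₂, ← add_assoc r₁]
      rfl
    · change _ = _ + ρ (swap 0 2 * swap 1 3) _
      rw [he.add_swap_mul_swap _ (by decide) (by decide) (by decide) (by decide) (by decide)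
        (by decide)]
      change _ = (0 + r₂) • (e 0 + e 2) + (r₁ + (r₁ + s₂)) • (e 1 + e 3)
      rw [zero_add, zmod_two_add_add]
      rfl
    · change _ = _ + ρ (swap 3 4) _
      rw [he.swap_sum _ (by decide)]
      change _ = ((r₁ + s₂) + ((r₁ + s₂) + r₃)) • (e 3 + e 4)
      rw [zmod_two_add_add]
      rfl
  · change ga = _ at h1
    change gb = _ at h2
    change gc = _ at h3
    subst h1 h2 h3
    obtain ⟨r₁, rfl⟩ := he.eq_smul_of_mem_swap hX hD ha (by decide)
    obtain ⟨r₂, rfl⟩ := he.eq_smul_of_mem_swap hX hD hb (by decide)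
    obtain ⟨r₃, s₃, rfl⟩ := double w 0 4 1 2 (by decide) (by decide) (by decide) (by decide)
      (by decide) (by decide) ⟨(swap 3 4 * swap 1 4)⁻¹, by decide +kernel⟩ hc
    -- Here the edges 01, 23, 04, 12 form a tree, so the coefficients of m can be solved for without
    -- any consistency condition.
    refine closure_ne_top_of_complement
      (∑ t, (![0, r₁, r₁ + s₃, r₁ + s₃ + r₂, r₃] : Fin 5 → ZMod 2) t • e t) ?_ ?_ ?_ h.closure_eq
    · change _ = _ + ρ (swap 0 1) _
      rw [he.swap_sum _ (by decide)]
      change _ = (0 + r₁) • (e 0 + e 1)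
      rw [zero_add]
      rfl
    · change _ = _ + ρ (swap 2 3) _
      rw [he.swap_sum _ (by decide)]
      change _ = ((r₁ + s₃) + ((r₁ + s₃) + r₂)) • (e 2 + e 3)
      rw [zmod_two_add_add]
      rfl
    · change _ = _ + ρ (swap 0 4 * swap 1 2) _
      rw [he.add_swap_mul_swap _ (by decide) (by decide) (by decide) (by decide) (by decide)
        (by decide)]
      change _ = (0 + r₃) • (e 0 + e 4) + (r₁ + (r₁ + s₃)) • (e 1 + e 2)
      rw [zero_add, zmod_two_add_add]
      rfl

end IsPermutationSystem

end PermutationModule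

/-! ### Reduction to standard generators and the conclusion. -/

section Standard

open Equiv

variable {θ : Perm (Fin 5) →* MulAut (Multiplicative (Fin 4 → ZMod 2))}

/-- Among the commuting involutions `a, b, ab` there are two that, with `c`, can be conjugated to
standard generators. -/
theorem IsTranspositionSet.exists_isStandardGenerating {X : Set (SplitGroup θ)}
    (hX : IsTranspositionSet X) {a b c : SplitGroup θ} (ha : a ∈ X) (hb : b ∈ X) (hc : c ∈ X)
    (hab : a * b ∈ X) (h : Subgroup.closure {a, b, c} = ⊤) :
    ∃ a' b' c', IsStandardGenerating X a' b' c' := by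
  have ha2 := hX.sq a ha
  have hb2 := hX.sq b hb
  have hcomm : a * b = b * a := by
    have h1 : (a * b)⁻¹ = a * b := inv_eq_of_mul_eq_one_left (hX.sq _ hab)
    rw [← h1, mul_inv_rev, inv_eq_of_mul_eq_one_left ha2, inv_eq_of_mul_eq_one_left hb2]
  have hright : Subgroup.closure {a.right, b.right, c.right} = ⊤ := by
    have h1 := congrArg (Subgroup.map SemidirectProduct.rightHom) h
    rw [MonoidHom.map_closure, Subgroup.map_top_of_surjective _
      SemidirectProduct.rightHom_surjective] at h1
    rw [← h1, Set.image_insert_eq, Set.image_insert_eq, Set.image_singleton]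
    rfl
  obtain ⟨g, x, hx, hs⟩ := exists_isStandardTriple
    (congrArg SemidirectProduct.right ha2) (congrArg SemidirectProduct.right hb2)
    (congrArg SemidirectProduct.right (hX.sq c hc)) (congrArg SemidirectProduct.right hcomm) hright
  -- Any two of a, b, ab generate the third, so replacing the pair (a, b) keeps the generated group.
  -- Conjugating by the lift of g with trivial first component then makes the images in S₅ standard.
  have main : ∀ a' b' : SplitGroup θ, a' ∈ X → b' ∈ X → a' * b' = b' * a' →
      a ∈ Subgroup.closure {a', b', c} → b ∈ Subgroup.closure {a', b', c} →
      x = (a'.right, b'.right) → ∃ a' b' c', IsStandardGenerating X a' b' c' := by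
    rintro a' b' ha' hb' hc' h1 h2 rfl
    refine ⟨_, _, _, hX.conj (pair θ 0 g) a' ha', hX.conj (pair θ 0 g) b' hb',
      hX.conj (pair θ 0 g) c hc, ?_, ?_, hs⟩
    · rw [conj_mul, conj_mul, hc']
    · have h3 : Subgroup.closure {a', b', c} = ⊤ := by
        rw [← top_le_iff, ← h, Subgroup.closure_le]
        rintro y (rfl | rfl | rfl)
        exacts [h1, h2, Subgroup.subset_closure (by simp)]
      have h4 := congrArg (Subgroup.map (MulAut.conj (pair θ 0 g)).toMonoidHom) h3
      rw [MonoidHom.map_closure, Subgroup.map_top_of_surjective _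
        (MulAut.conj (pair θ 0 g)).surjective] at h4
      rw [← h4, Set.image_insert_eq, Set.image_insert_eq, Set.image_singleton]
      rfl
  have hb' : a * (a * b) = b := by rw [← mul_assoc, ha2, one_mul]
  have ha' : b * (a * b) = a := by rw [hcomm, ← mul_assoc, hb2, one_mul]
  have hba' : a * b * a = b := by rw [mul_assoc, ← hcomm, hb']
  have hab' : a * b * b = a := by rw [mul_assoc, hb2, mul_one]
  have m1 : ∀ {u v : SplitGroup θ}, u ∈ Subgroup.closure {u, v, c} := fun {u v} =>
    Subgroup.subset_closure (by simp)
  have m2 : ∀ {u v : SplitGroup θ}, v ∈ Subgroup.closure {u, v, c} := fun {u v} =>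
    Subgroup.subset_closure (by simp)
  have m3 : ∀ {u v w : SplitGroup θ}, u * v = w → w ∈ Subgroup.closure {u, v, c} := by
    rintro u v w rfl
    exact mul_mem m1 m2
  simp only [List.mem_cons, List.not_mem_nil, or_false] at hx
  rcases hx with hx | hx | hx | hx | hx | hx
  · exact main a b ha hb hcomm m1 m2 hx
  · exact main b a hb ha hcomm.symm m2 m1 hx
  · exact main a (a * b) ha hab (hb'.trans hba'.symm) m1 (m3 hb') hx
  · exact main (a * b) a hab ha (hba'.trans hb'.symm) m2 (m3 hba') hx
  · exact main b (a * b) hb hab (ha'.trans hab'.symm) (m3 ha') m1 hx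
  · exact main (a * b) b hab hb (hab'.trans ha'.symm) (m3 hab') m2 hx

theorem IsTranspositionSet.hasConfiguration_of_closure {X : Set (SplitGroup θ)}
    (hX : IsTranspositionSet X) {a b c : SplitGroup θ} (ha : a ∈ X) (hb : b ∈ X) (hc : c ∈ X)
    (hab : a * b ∈ X) (h : Subgroup.closure {a, b, c} = ⊤) : HasConfiguration X := by
  obtain ⟨a', b', c', hs⟩ := hX.exists_isStandardGenerating ha hb hc hab h
  by_cases hP : FixedEqRange θ (swap 0 1)
  · exact hX.hasConfiguration hs hP
  · have hω := hX.linearAction_fiveCycle_ne_one hs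
    obtain ⟨e, he⟩ := exists_isPermutationSystem hω hP
    exact (he.not_isStandardGenerating hX hω hs).elim

end Standard

/-- The union of the conjugacy classes in the definition of a triangle-point group. -/
def triangleClasses {G : Type*} [Group G] (a b c : G) : Set G :=
  {t | IsConj a t ∨ IsConj b t ∨ IsConj c t ∨ IsConj (a * b) t}

theorem IsTrianglePoint.hasConfiguration {G : Type*} [Group G] (hG : IsTwoPowFourSplitS5 G)
    {a b c : G} (h : IsTrianglePoint a b c) : HasConfiguration (triangleClasses a b c) := by
  obtain ⟨θ, ⟨e⟩⟩ := hG
  set X : Set (SplitGroup θ) := e.symm ⁻¹' triangleClasses a b c with hXdef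
  have mem : ∀ t ∈ triangleClasses a b c, e t ∈ X := fun t ht => by
    rwa [hXdef, Set.mem_preimage, e.symm_apply_apply]
  have hX : IsTranspositionSet X := by
    refine ⟨fun k x hx => ?_, fun x hx => ?_, fun x hx y hy => ?_⟩
    · have hk : IsConj (e.symm x) (e.symm (k * x * k⁻¹)) :=
        isConj_iff.mpr ⟨e.symm k, by simp⟩
      exact hx.imp (·.trans hk) (Or.imp (·.trans hk) (Or.imp (·.trans hk) (·.trans hk)))
    · have ho : orderOf (e.symm x) = 2 := by
        rcases hx with hx | hx | hx | hx
        · obtain ⟨k, hk⟩ := isConj_iff.mp hx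
          rw [← hk, ← MulAut.conj_apply, MulEquiv.orderOf_eq, h.order_a]
        · obtain ⟨k, hk⟩ := isConj_iff.mp hx
          rw [← hk, ← MulAut.conj_apply, MulEquiv.orderOf_eq, h.order_b]
        · obtain ⟨k, hk⟩ := isConj_iff.mp hx
          rw [← hk, ← MulAut.conj_apply, MulEquiv.orderOf_eq, h.order_c]
        · obtain ⟨k, hk⟩ := isConj_iff.mp hx
          rw [← hk, ← MulAut.conj_apply, MulEquiv.orderOf_eq, h.order_ab]
      rw [MulEquiv.orderOf_eq] at ho
      rw [← sq]
      exact orderOf_dvd_iff_pow_eq_one.mp ho.dvd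
    · have ho := h.order_mul_le _ _ hx hy
      rwa [← map_mul, MulEquiv.orderOf_eq] at ho
  have hcl : Subgroup.closure {e a, e b, e c} = ⊤ := by
    have h1 := congrArg (Subgroup.map e.toMonoidHom) h.generates
    rw [MonoidHom.map_closure, Subgroup.map_top_of_surjective _ e.surjective] at h1
    rw [← h1, Set.image_insert_eq, Set.image_insert_eq, Set.image_singleton]
    rfl
  obtain ⟨p, q, w, f, ⟨hp, hq, hw, hf⟩, ⟨hpw, hqw, hpf, hqf, hpwf, hqwf⟩, h1, h2, h3, h4, h5, hne⟩ :=
    hX.hasConfiguration_of_closure (mem a (Or.inl (IsConj.refl a)))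
      (mem b (Or.inr (Or.inl (IsConj.refl b)))) (mem c (Or.inr (Or.inr (Or.inl (IsConj.refl c)))))
      (by rw [← map_mul]; exact mem _ (Or.inr (Or.inr (Or.inr (IsConj.refl _))))) hcl
  simp only [hXdef, Set.mem_preimage, map_mul] at hp hq hw hf hpw hqw hpf hqf hpwf hqwf
  refine ⟨e.symm p, e.symm q, e.symm w, e.symm f, ⟨hp, hq, hw, hf⟩,
    ⟨hpw, hqw, hpf, hqf, hpwf, hqwf⟩, ?_, ?_, ?_, ?_, ?_, fun hwf => hne (e.symm.injective hwf)⟩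
  · simp only [← map_mul, h1]
  · simp only [← map_mul, h2]
  · simp only [← map_mul, h3]
  · simp only [← map_mul, h4]
  · simp only [← map_mul, h5]

theorem Representation.triangleClasses_subset {G : Type*} [Group G] {T : Set G} {V : Type*}
    [NormedAddCommGroup V] [InnerProductSpace ℝ V] (R : Representation G T V) {a b c : G}
    (ha : a ∈ T) (hb : b ∈ T) (hc : c ∈ T) (hab : a * b ∈ T) : triangleClasses a b c ⊆ T := by
  have key : ∀ s ∈ T, ∀ t, IsConj s t → t ∈ T := by
    intro s hs t hst
    obtain ⟨k, rfl⟩ := isConj_iff.mp hst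
    exact R.T_stable k s hs
  rintro t (ht | ht | ht | ht)
  exacts [key _ ha _ ht, key _ hb _ ht, key _ hc _ ht, key _ hab _ ht]

end Majorana

theorem mainTheorem5 {G : Type*} [Group G] (hG : Majorana.IsTwoPowFourSplitS5 G)
    (a b c : G) (habc : Majorana.IsTrianglePoint a b c)
    (T : Set G) (ha : a ∈ T) (hb : b ∈ T) (hc : c ∈ T) (hab : a * b ∈ T)
    (V : Type*) [NormedAddCommGroup V] [InnerProductSpace ℝ V] :
    IsEmpty (Majorana.Representation G T V) := by
  refine ⟨fun R => ?_⟩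
  have hT := R.triangleClasses_subset ha hb hc hab
  obtain ⟨p, q, w, f, ⟨hp, hq, hw, hf⟩, ⟨hpw, hqw, hpf, hqf, hpwf, hqwf⟩, h1, h2, h3, h4, h5, hne⟩ :=
    habc.hasConfiguration hG
  exact R.false_of_configuration (hT hp) (hT hq) (hT hw) (hT hf) (hT hpw) (hT hqw) (hT hpf)
    (hT hqf) (hT hpwf) (hT hqwf) h1 h2 h3 h4 h5 hne
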